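/- Let $\Bbbk$ be a field, $\mathcal{C}$ a small $\Bbbk$-linear monoidal category (with bilinear tensor product) and $\mathbf{M}$ a $\Bbbk$-linear left $\mathcal{C}$-module category, with coherence isomorphisms $\mathbf{m}_{F,G}:\mathbf{M}F\circ\mathbf{M}G\to\mathbf{M}(F\otimes G)$ and $\mathbf{m}_{0}:\mathrm{Id}\to\mathbf{M}\mathbb{1}$; we write $FX$ for $\mathbf{M}F(X)$. Notation. A Tambara module (from $\mathcal{C}$ to $\mathcal{C}$) is a $\Bbbk$-linear functor $P:\mathcal{C}^{\mathrm{op}}\otimes_{\Bbbk}\mathcal{C}\to\mathbf{Vec}_{\Bbbk}$ together with maps $P(F,G)\to P(H\otimes F,H\otimes G)$ for $H\in\mathcal{C}$, natural in $F,G$, extranatural in $H$, and compatible with the associator and the unitors of $\mathcal{C}$. A morphism of Tambara modules is a natural transformation compatible with these maps. Tambara modules form a monoidal category with tensor product $(P\diamond Q)(F,G)=\int^{H}P(F,H)\otimes_{\Bbbk}Q(H,G)$ and unit $\mathcal{C}(-,-)$. For $X,Y\in\mathbf{M}$ let $[X,Y](F,G)=\mathrm{Hom}_{\mathbf{M}}(FX,GY)$,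 with Tambara structure $x\mapsto \mathbf{m}_{H,G}\circ\mathbf{M}H(x)\circ\mathbf{m}_{H,F}^{-1}$. Composition gives morphisms $[X,Y]\diamond[Y,Z]\to[X,Z]$, $b\otimes c\mapsto c\circ b$, and there are unit morphisms $\mathcal{C}(-,-)\to[X,X]$, $f\mapsto\mathbf{M}f_X$. Thus $[X,X]$ is a monoid in the category of Tambara modules and $[X,Y]$ is an $[X,X]$-$[Y,Y]$-bimodule. For a $\Bbbk$-linear presheaf $P:\mathcal{C}^{\mathrm{op}}\to\mathbf{Vec}_{\Bbbk}$ let $\mathbb{W}(P)(F,G)=\int^{H}\mathcal{C}(F,G\otimes H)\otimes_{\Bbbk}P(H)$, with Tambara structure induced by $K\otimes-:\mathcal{C}(F,G\otimes H)\to\mathcal{C}(K\otimes F,K\otimes(G\otimes H))\cong\mathcal{C}(K\otimes F,(K\otimes G)\otimes H)$. There are structure morphisms $\mathbb{W}(P)\diamond\mathbb{W}(Q)\to\mathbb{W}(Q\ast P)$, $(f\otimes x)\otimes(l\otimes y)\mapsto((l\otimes H')\circ f)\otimes[\mathrm{id}_{H\otimes H'}\otimes(y\otimes x)]$ for $f:F\to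 L\otimes H'$, $x\in P(H')$, $l:L\to G\otimes H$, $y\in Q(H)$ (associator suppressed), where $\ast$ is Day convolution, and $\mathcal{C}(-,-)\to\mathbb{W}(\mathcal{C}(-,\mathbb{1}))$, $f\mapsto f\otimes\mathrm{id}_{\mathbb 1}$ (unitor suppressed). For the presheaves $\mathrm{Hom}(-X,Y):H\mapsto\mathrm{Hom}_{\mathbf{M}}(HX,Y)$ there are composition morphisms $\mathrm{Hom}(-Y,Z)\ast\mathrm{Hom}(-X,Y)\to\mathrm{Hom}(-X,Z)$, given by $f\otimes(b\otimes c)\mapsto b\circ\mathbf{M}H(c)\circ\mathbf{m}_{H,K}^{-1}\circ\mathbf{M}f_X$ for $f:F\to H\otimes K$, $b:HY\to Z$, $c:KX\to Y$, and unit morphisms $\mathcal{C}(-,\mathbb{1})\to\mathrm{Hom}(-X,X)$, $f\mapsto\mathbf{m}_0^{-1}\circ\mathbf{M}f_X$. Combined with the structure morphisms of $\mathbb{W}$ they make $\mathbb{W}(\mathrm{Hom}(-X,X))$ a monoid in the category of Tambara modules and $\mathbb{W}(\mathrm{Hom}(-X,Y))$ a $\mathbb{W}(\mathrm{Hom}(-X,X))$-$\mathbb{W}(\mathrm{Hom}(-Y,Y))$-bimodule.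 Corollary. For all $X,Y\in\mathbf{M}$ there is a morphism of Tambara modules $$\omega_{X,Y}:\mathbb{W}(\mathrm{Hom}(-X,Y))\to[X,Y]$$ such that $\omega_{X,Y}(f\otimes b)=\mathbf{M}G(b)\circ\mathbf{m}_{G,H}^{-1}\circ\mathbf{M}f_X$ for all $f:F\to G\otimes H$ in $\mathcal{C}$ and $b:HX\to Y$ in $\mathbf{M}$, and 1. for each $X$, $\omega_{X,X}:\mathbb{W}(\mathrm{Hom}(-X,X))\to[X,X]$ is a morphism of monoids; 2. for all $X,Y$, $\omega_{X,Y}$ is a morphism of $\mathbb{W}(\mathrm{Hom}(-X,X))$-$\mathbb{W}(\mathrm{Hom}(-Y,Y))$-bimodules, where $[X,Y]$ is regarded as such a bimodule by restriction along the monoid morphisms $\omega_{X,X}$ and $\omega_{Y,Y}$; 3. if $\mathcal{C}$ is rigid (every object has a left and a right dual), then all $\omega_{X,Y}$ are isomorphisms: of Tambara modules and of bimodules for all $X,Y$, and of monoids when $X=Y$. -/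

import Mathlib

open CategoryTheory MonoidalCategory MonoidalLeftAction
open scoped TensorProduct

set_option linter.unusedSectionVars false

-- Morphism types are elaborated through the quiver underlying the category structure itself.
attribute [-instance] CategoryTheory.catToReflQuiver

universe w u v

/-- A `k`-linear module category over a `k`-linear monoidal category `C`: the action
`C ⥤ (M ⥤ M)` takes values in `k`-linear functors and is itself `k`-linear. -/
class IsLinearAction (k : Type w) [Field k] (C : Type u) [SmallCategory C] [Preadditive C]
    [Linear k C] [MonoidalCategory C] (M : Type v) [Category.{u} M] [Preadditive M] [Linear k M]
    [MonoidalLeftAction C M] : Prop where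
  actionHomRight_add (F : C) {X Y : M} (a b : X ⟶ Y) : F ⊴ₗ (a + b) = F ⊴ₗ a + F ⊴ₗ b
  actionHomRight_smul (F : C) {X Y : M} (r : k) (a : X ⟶ Y) : F ⊴ₗ (r • a) = r • F ⊴ₗ a
  add_actionHomLeft {F G : C} (f g : F ⟶ G) (X : M) : (f + g) ⊵ₗ X = f ⊵ₗ X + g ⊵ₗ X
  smul_actionHomLeft {F G : C} (r : k) (f : F ⟶ G) (X : M) : (r • f) ⊵ₗ X = r • f ⊵ₗ X

noncomputable section

namespace Tambara

/-! ### Coends `∫^H A(H) ⊗ B(H)` -/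

section Coend

variable (k : Type w) [Field k] {J : Type u} [Category.{u} J]
  {A B : J → Type u} [∀ H, AddCommGroup (A H)] [∀ H, Module k (A H)]
  [∀ H, AddCommGroup (B H)] [∀ H, Module k (B H)]
  (am : ∀ {H H' : J}, (H ⟶ H') → A H →ₗ[k] A H')
  (bm : ∀ {H H' : J}, (H ⟶ H') → B H' →ₗ[k] B H)

open Classical in
/-- The subspace of `⨁ H, A H ⊗ B H` spanned by the relations `A(h)(a) ⊗ b ∼ a ⊗ B(h)(b)`. -/
def coendRel : Submodule k (DirectSum J fun H => A H ⊗[k] B H) :=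
  Submodule.span k {x | ∃ (H H' : J) (h : H ⟶ H') (a : A H) (b : B H'),
    x = DirectSum.lof k J (fun H => A H ⊗[k] B H) H' (am h a ⊗ₜ b)
      - DirectSum.lof k J (fun H => A H ⊗[k] B H) H (a ⊗ₜ bm h b)}

/-- The coend `∫^H A(H) ⊗ B(H)` for `A` covariant and `B` contravariant in `H`, as a quotient
of the direct sum `⨁ H, A H ⊗ B H`. -/
def Coend : Type u := (DirectSum J fun H => A H ⊗[k] B H) ⧸ coendRel k am bm

instance : AddCommGroup (Coend k am bm) :=
  inferInstanceAs (AddCommGroup ((DirectSum J fun H => A H ⊗[k] B H) ⧸ coendRel k am bm))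

instance : Module k (Coend k am bm) :=
  inferInstanceAs (Module k ((DirectSum J fun H => A H ⊗[k] B H) ⧸ coendRel k am bm))

namespace Coend

open Classical in
/-- The class of the pure tensor `a ⊗ b` in the summand indexed by `H`. -/
def mk (H : J) : A H →ₗ[k] B H →ₗ[k] Coend k am bm :=
  TensorProduct.curry
    ((coendRel k am bm).mkQ ∘ₗ DirectSum.lof k J (fun H => A H ⊗[k] B H) H)

theorem mk_rel {H H' : J} (h : H ⟶ H') (a : A H) (b : B H') :
    mk k am bm H' (am h a) b = mk k am bm H a (bm h b) := by
  refine (Submodule.Quotient.eq (coendRel k am bm)).2 ?_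
  exact Submodule.subset_span ⟨H, H', h, a, b, rfl⟩

theorem induction {p : Coend k am bm → Prop} (x : Coend k am bm) (h0 : p 0)
    (hadd : ∀ x y, p x → p y → p (x + y)) (hmk : ∀ H a b, p (mk k am bm H a b)) : p x := by
  classical
  obtain ⟨y, rfl⟩ := (coendRel k am bm).mkQ_surjective x
  induction y using DirectSum.induction_on with
  | zero => rw [map_zero]; exact h0
  | add x y hx hy => rw [map_add]; exact hadd _ _ hx hy
  | of H t =>
    induction t using TensorProduct.induction_on with
    | zero => rw [map_zero, map_zero]; exact h0
    | add x y hx hy => rw [map_add, map_add]; exact hadd _ _ hx hy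
    | tmul a b => exact hmk H a b

variable {am bm} {V : Type*} [AddCommGroup V] [Module k V]

open Classical in
/-- A compatible (extranatural) family of bilinear maps induces a linear map on the coend. -/
def lift (f : ∀ H, A H →ₗ[k] B H →ₗ[k] V)
    (hf : ∀ (H H' : J) (h : H ⟶ H') (a : A H) (b : B H'), f H' (am h a) b = f H a (bm h b)) :
    Coend k am bm →ₗ[k] V :=
  (coendRel k am bm).liftQ (DirectSum.toModule k J V fun H => TensorProduct.lift (f H)) <| by
    refine Submodule.span_le.2 ?_
    rintro _ ⟨H, H', h, a, b, rfl⟩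
    simp [hf]

@[simp]
theorem lift_mk (f : ∀ H, A H →ₗ[k] B H →ₗ[k] V)
    (hf : ∀ (H H' : J) (h : H ⟶ H') (a : A H) (b : B H'), f H' (am h a) b = f H a (bm h b))
    (H : J) (a : A H) (b : B H) : lift k f hf (mk k am bm H a b) = f H a b := by
  classical
  refine (Submodule.liftQ_apply _ _ _).trans ?_
  simp

theorem hom_ext {f g : Coend k am bm →ₗ[k] V}
    (h : ∀ H a b, f (mk k am bm H a b) = g (mk k am bm H a b)) : f = g := by
  ext x
  induction x using Coend.induction with
  | h0 => simp
  | hadd x y hx hy => simp [hx, hy]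
  | hmk H a b => exact h H a b

section map

variable {J' : Type u} [Category.{u} J'] {A' B' : J' → Type u} [∀ H, AddCommGroup (A' H)]
  [∀ H, Module k (A' H)] [∀ H, AddCommGroup (B' H)] [∀ H, Module k (B' H)]
  {am' : ∀ {H H' : J'}, (H ⟶ H') → A' H →ₗ[k] A' H'}
  {bm' : ∀ {H H' : J'}, (H ⟶ H') → B' H' →ₗ[k] B' H}

/-- The map between coends induced by maps on the two factors. -/
def map (φ : J → J') (s : ∀ H, A H →ₗ[k] A' (φ H)) (t : ∀ H, B H →ₗ[k] B' (φ H))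
    (hst : ∀ (H H' : J) (h : H ⟶ H') (a : A H) (b : B H'),
      mk k am' bm' (φ H') (s H' (am h a)) (t H' b) = mk k am' bm' (φ H) (s H a) (t H (bm h b))) :
    Coend k am bm →ₗ[k] Coend k am' bm' :=
  lift k (fun H => (mk k am' bm' (φ H)).compl₁₂ (s H) (t H)) hst

@[simp]
theorem map_mk (φ : J → J') (s : ∀ H, A H →ₗ[k] A' (φ H)) (t : ∀ H, B H →ₗ[k] B' (φ H))
    (hst : ∀ (H H' : J) (h : H ⟶ H') (a : A H) (b : B H'),
      mk k am' bm' (φ H') (s H' (am h a)) (t H' b) = mk k am' bm' (φ H) (s H a) (t H (bm h b)))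
    (H : J) (a : A H) (b : B H) :
    map k φ s t hst (mk k am bm H a b) = mk k am' bm' (φ H) (s H a) (t H b) :=
  lift_mk k _ hst H a b

end map

end Coend

end Coend

variable (k : Type w) [Field k] (C : Type u) [SmallCategory C] [Preadditive C] [Linear k C]

/-! ### Linear profunctors and presheaves -/

/-- A `k`-linear profunctor from `C` to `C`, i.e. a `k`-linear functor `Cᵒᵖ ⊗ C → Vec_k`. -/
structure LinProf where
  obj : C → C → Type u
  [grp : ∀ F G, AddCommGroup (obj F G)]
  [mod : ∀ F G, Module k (obj F G)]
  /-- contravariant functoriality in the first variable -/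
  lmap {F F' : C} (G : C) : (F' ⟶ F) →ₗ[k] obj F G →ₗ[k] obj F' G
  /-- covariant functoriality in the second variable -/
  rmap (F : C) {G G' : C} : (G ⟶ G') →ₗ[k] obj F G →ₗ[k] obj F G'
  lmap_id {F G : C} (x : obj F G) : lmap G (𝟙 F) x = x
  lmap_comp {F F' F'' G : C} (f : F'' ⟶ F') (f' : F' ⟶ F) (x : obj F G) :
    lmap G (f ≫ f') x = lmap G f (lmap G f' x)
  rmap_id {F G : C} (x : obj F G) : rmap F (𝟙 G) x = x
  rmap_comp {F G G' G'' : C} (g : G ⟶ G') (g' : G' ⟶ G'') (x : obj F G) :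
    rmap F (g ≫ g') x = rmap F g' (rmap F g x)
  lmap_rmap {F F' G G' : C} (f : F' ⟶ F) (g : G ⟶ G') (x : obj F G) :
    lmap G' f (rmap F g x) = rmap F' g (lmap G f x)

attribute [instance] LinProf.grp LinProf.mod
attribute [simp] LinProf.lmap_id LinProf.rmap_id

/-- A `k`-linear presheaf `Cᵒᵖ → Vec_k`. -/
structure LinPsh where
  obj : C → Type u
  [grp : ∀ F, AddCommGroup (obj F)]
  [mod : ∀ F, Module k (obj F)]
  map {F F' : C} : (F' ⟶ F) →ₗ[k] obj F →ₗ[k] obj F'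
  map_id {F : C} (x : obj F) : map (𝟙 F) x = x
  map_comp {F F' F'' : C} (f : F'' ⟶ F') (f' : F' ⟶ F) (x : obj F) :
    map (f ≫ f') x = map f (map f' x)

attribute [instance] LinPsh.grp LinPsh.mod
attribute [simp] LinPsh.map_id

variable {k C} in
/-- A morphism of linear presheaves. -/
structure LinPsh.Hom (P Q : LinPsh k C) where
  app (F : C) : P.obj F →ₗ[k] Q.obj F
  naturality {F F' : C} (f : F' ⟶ F) (x : P.obj F) : app F' (P.map f x) = Q.map f (app F x)

/-! ### Tambara modules -/

variable [MonoidalCategory C]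

/-- A Tambara module from `C` to `C`, where `C` is regarded as a left module category over
itself. -/
structure TambMod extends LinProf k C where
  /-- the Tambara structure -/
  str (H : C) {F G : C} : obj F G →ₗ[k] obj (H ⊗ F) (H ⊗ G)
  str_lmap (H : C) {F F' G : C} (f : F' ⟶ F) (x : obj F G) :
    str H (lmap G f x) = lmap (H ⊗ G) (H ◁ f) (str H x)
  str_rmap (H : C) {F G G' : C} (g : G ⟶ G') (x : obj F G) :
    str H (rmap F g x) = rmap (H ⊗ F) (H ◁ g) (str H x)
  str_extranatural {H H' : C} (h : H ⟶ H') {F G : C} (x : obj F G) :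
    lmap (H' ⊗ G) (h ▷ F) (str H' x) = rmap (H ⊗ F) (h ▷ G) (str H x)
  str_tensor (K H : C) {F G : C} (x : obj F G) :
    lmap ((K ⊗ H) ⊗ G) (α_ K H F).inv (str (K ⊗ H) x) =
      rmap (K ⊗ (H ⊗ F)) (α_ K H G).inv (str K (str H x))
  str_unit {F G : C} (x : obj F G) :
    lmap G (λ_ F).inv (rmap (𝟙_ C ⊗ F) (λ_ G).hom (str (𝟙_ C) x)) = x

variable {k C}

namespace TambMod

/-- A morphism of Tambara modules: a morphism of profunctors compatible with the Tambara
structures. -/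
@[ext]
structure Hom (P Q : TambMod k C) where
  app (F G : C) : P.obj F G →ₗ[k] Q.obj F G
  app_lmap {F F' G : C} (f : F' ⟶ F) (x : P.obj F G) :
    app F' G (P.lmap G f x) = Q.lmap G f (app F G x)
  app_rmap {F G G' : C} (g : G ⟶ G') (x : P.obj F G) :
    app F G' (P.rmap F g x) = Q.rmap F g (app F G x)
  app_str (H : C) {F G : C} (x : P.obj F G) :
    app (H ⊗ F) (H ⊗ G) (P.str H x) = Q.str H (app F G x)

instance : Category (TambMod k C) where
  Hom := Hom
  id P :=
    { app := fun _ _ => LinearMap.id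
      app_lmap := fun _ _ => rfl
      app_rmap := fun _ _ => rfl
      app_str := fun _ _ _ _ => rfl }
  comp s t :=
    { app := fun F G => t.app F G ∘ₗ s.app F G
      app_lmap := fun f x => by simp [s.app_lmap, t.app_lmap]
      app_rmap := fun f x => by simp [s.app_rmap, t.app_rmap]
      app_str := fun H _ _ x => by simp [s.app_str, t.app_str] }

@[simp]
theorem id_app (P : TambMod k C) (F G : C) (x : P.obj F G) : Hom.app (𝟙 P) F G x = x := rfl

@[simp]
theorem comp_app {P Q R : TambMod k C} (s : P ⟶ Q) (t : Q ⟶ R) (F G : C) (x : P.obj F G) :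
    Hom.app (s ≫ t) F G x = t.app F G (s.app F G x) := rfl

theorem hom_ext {P Q : TambMod k C} {s t : P ⟶ Q}
    (h : ∀ F G (x : P.obj F G), s.app F G x = t.app F G x) : s = t :=
  Hom.ext (by funext F G; exact LinearMap.ext (h F G))

/-- An isomorphism of Tambara modules from a Tambara morphism with pointwise inverses. -/
def isoMk {P Q : TambMod k C} (s : P ⟶ Q) (t : ∀ F G, Q.obj F G →ₗ[k] P.obj F G)
    (hst : ∀ F G x, t F G (s.app F G x) = x) (hts : ∀ F G x, s.app F G (t F G x) = x) :
    P ≅ Q where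
  hom := s
  inv :=
    { app := t
      app_lmap := fun {F F' G} f x => by
        conv_lhs => rw [← hts F G x, ← s.app_lmap, hst]
      app_rmap := fun {F G G'} f x => by
        conv_lhs => rw [← hts F G x, ← s.app_rmap, hst]
      app_str := fun H F G x => by
        conv_lhs => rw [← hts F G x, ← s.app_str, hst] }
  hom_inv_id := hom_ext fun F G x => hst F G x
  inv_hom_id := hom_ext fun F G x => hts F G x

@[simp]
theorem isoMk_hom {P Q : TambMod k C} (s : P ⟶ Q) (t : ∀ F G, Q.obj F G →ₗ[k] P.obj F G)
    (hst hts) : (isoMk s t hst hts).hom = s := rfl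

@[simp]
theorem isoMk_inv_app {P Q : TambMod k C} (s : P ⟶ Q) (t : ∀ F G, Q.obj F G →ₗ[k] P.obj F G)
    (hst hts) (F G : C) (x : Q.obj F G) : (isoMk s t hst hts).inv.app F G x = t F G x := rfl

/-! ### The composite of Tambara modules -/

section Comp

variable (P Q R : TambMod k C)

/-- The composite `(P ⋄ Q)(F, G) = ∫^H P(F, H) ⊗ Q(H, G)`. -/
def compObj (F G : C) : Type u :=
  Coend k (J := C) (A := fun H => P.obj F H) (B := fun H => Q.obj H G)
    (fun h => P.rmap F h) (fun h => Q.lmap G h)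

instance (F G : C) : AddCommGroup (compObj P Q F G) := inferInstanceAs (AddCommGroup (Coend ..))

instance (F G : C) : Module k (compObj P Q F G) := inferInstanceAs (Module k (Coend ..))

/-- The class of `p ⊗ q` in the composite. -/
def cmk {F G : C} (H : C) : P.obj F H →ₗ[k] Q.obj H G →ₗ[k] compObj P Q F G :=
  Coend.mk k (J := C) (A := fun H => P.obj F H) (B := fun H => Q.obj H G)
    (fun h => P.rmap F h) (fun h => Q.lmap G h) H

theorem cmk_rel {F G H H' : C} (h : H ⟶ H') (p : P.obj F H) (q : Q.obj H' G) :
    cmk P Q H' (P.rmap F h p) q = cmk P Q H p (Q.lmap G h q) :=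
  Coend.mk_rel k (J := C) (A := fun H => P.obj F H) (B := fun H => Q.obj H G)
    (fun h => P.rmap F h) (fun h => Q.lmap G h) h p q

variable {P Q} in
theorem cind {F G : C} {p : compObj P Q F G → Prop} (x : compObj P Q F G) (h0 : p 0)
    (hadd : ∀ x y, p x → p y → p (x + y)) (hmk : ∀ H a b, p (cmk P Q H a b)) : p x :=
  Coend.induction k _ _ x h0 hadd hmk

variable {P Q} in
/-- Linear maps out of the composite. -/
def clift {V : Type*} [AddCommGroup V] [Module k V] {F G : C}
    (f : ∀ H, P.obj F H →ₗ[k] Q.obj H G →ₗ[k] V)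
    (hf : ∀ (H H' : C) (h : H ⟶ H') (a : P.obj F H) (b : Q.obj H' G),
      f H' (P.rmap F h a) b = f H a (Q.lmap G h b)) : compObj P Q F G →ₗ[k] V :=
  Coend.lift k f hf

@[simp]
theorem clift_cmk {V : Type*} [AddCommGroup V] [Module k V] {F G : C}
    (f : ∀ H, P.obj F H →ₗ[k] Q.obj H G →ₗ[k] V)
    (hf : ∀ (H H' : C) (h : H ⟶ H') (a : P.obj F H) (b : Q.obj H' G),
      f H' (P.rmap F h a) b = f H a (Q.lmap G h b)) (H : C) (a : P.obj F H) (b : Q.obj H G) :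
    clift f hf (cmk P Q H a b) = f H a b :=
  Coend.lift_mk k f hf H a b

variable {P Q} in
theorem cext {V : Type*} [AddCommGroup V] [Module k V] {F G : C}
    {f g : compObj P Q F G →ₗ[k] V}
    (h : ∀ H a b, f (cmk P Q H a b) = g (cmk P Q H a b)) : f = g :=
  Coend.hom_ext k h

/-- The map between composites induced by maps on the two factors. -/
def cmap {P Q P' Q' : TambMod k C} {F G F' G' : C} (φ : C → C)
    (s : ∀ H, P.obj F H →ₗ[k] P'.obj F' (φ H)) (t : ∀ H, Q.obj H G →ₗ[k] Q'.obj (φ H) G')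
    (hst : ∀ (H H' : C) (h : H ⟶ H') (a : P.obj F H) (b : Q.obj H' G),
      cmk P' Q' (φ H') (s H' (P.rmap F h a)) (t H' b) =
        cmk P' Q' (φ H) (s H a) (t H (Q.lmap G h b))) :
    compObj P Q F G →ₗ[k] compObj P' Q' F' G' :=
  clift (fun H => (cmk P' Q' (φ H)).compl₁₂ (s H) (t H)) hst

@[simp]
theorem cmap_cmk {P Q P' Q' : TambMod k C} {F G F' G' : C} (φ : C → C)
    (s : ∀ H, P.obj F H →ₗ[k] P'.obj F' (φ H)) (t : ∀ H, Q.obj H G →ₗ[k] Q'.obj (φ H) G')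
    (hst : ∀ (H H' : C) (h : H ⟶ H') (a : P.obj F H) (b : Q.obj H' G),
      cmk P' Q' (φ H') (s H' (P.rmap F h a)) (t H' b) =
        cmk P' Q' (φ H) (s H a) (t H (Q.lmap G h b)))
    (H : C) (a : P.obj F H) (b : Q.obj H G) :
    cmap φ s t hst (cmk P Q H a b) = cmk P' Q' (φ H) (s H a) (t H b) :=
  clift_cmk P Q _ _ H a b

/-- The composite `P ⋄ Q` of Tambara modules. Its structure maps send `p ⊗ q` to
`str H p ⊗ str H q`. -/
def comp : TambMod k C where
  obj := compObj P Q
  lmap {F F'} G :=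
    { toFun := fun f => cmap id (fun H => P.lmap H f) (fun _ => LinearMap.id)
        (fun H H' h a b => by simp [P.lmap_rmap, cmk_rel])
      map_add' := fun f f' => cext fun H a b => by simp
      map_smul' := fun r f => cext fun H a b => by simp }
  rmap F {G G'} :=
    { toFun := fun g => cmap id (fun _ => LinearMap.id) (fun H => Q.rmap H g)
        (fun H H' h a b => by simp [Q.lmap_rmap, cmk_rel])
      map_add' := fun f f' => cext fun H a b => by simp
      map_smul' := fun r f => cext fun H a b => by simp }
  lmap_id x := by induction x using cind <;> simp_all
  lmap_comp f f' x := by induction x using cind <;> simp_all [P.lmap_comp]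
  rmap_id x := by induction x using cind <;> simp_all
  rmap_comp f f' x := by induction x using cind <;> simp_all [Q.rmap_comp]
  lmap_rmap f g x := by induction x using cind <;> simp_all
  str H {F G} := cmap (fun L => H ⊗ L) (fun _ => P.str H) (fun _ => Q.str H)
    (fun L L' h a b => by simp [P.str_rmap, Q.str_lmap, cmk_rel])
  str_lmap H _ _ _ f x := by induction x using cind <;> simp_all [P.str_lmap]
  str_rmap H _ _ _ f x := by induction x using cind <;> simp_all [Q.str_rmap]
  str_extranatural h F G x := by
    induction x using cind with
    | h0 => simp
    | hadd x y hx hy => simp_all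
    | hmk L a b => simp [P.str_extranatural, cmk_rel, Q.str_extranatural]
  str_tensor K H F G x := by
    induction x using cind with
    | h0 => simp
    | hadd x y hx hy => simp_all
    | hmk L a b => simp [← Q.str_tensor, ← cmk_rel, ← P.str_tensor]
  str_unit {F G} x := by
    induction x using cind with
    | h0 => simp
    | hadd x y hx hy => simp_all
    | hmk L a b =>
      have h1 : P.rmap F (λ_ L).inv a = P.lmap (𝟙_ C ⊗ L) (λ_ F).inv (P.str (𝟙_ C) a) := by
        conv_lhs => rw [← P.str_unit a, P.lmap_rmap, ← P.rmap_comp]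
        simp
      simp only [LinearMap.coe_mk, AddHom.coe_mk, cmap_cmk, id, LinearMap.id_apply]
      rw [← h1, cmk_rel, Q.str_unit]

end Comp

section

variable (P Q R : TambMod k C)

/-- The class of `p ⊗ q` in `(P ⋄ Q)(F, G)`. -/
def cpair {F G : C} (H : C) : P.obj F H →ₗ[k] Q.obj H G →ₗ[k] (comp P Q).obj F G :=
  cmk P Q H

theorem cpair_rel {F G H H' : C} (h : H ⟶ H') (p : P.obj F H) (q : Q.obj H' G) :
    cpair P Q H' (P.rmap F h p) q = cpair P Q H p (Q.lmap G h q) :=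
  cmk_rel P Q h p q

@[simp]
theorem comp_lmap_cpair {F F' G : C} (f : F' ⟶ F) (H : C) (a : P.obj F H) (b : Q.obj H G) :
    (comp P Q).lmap G f (cpair P Q H a b) = cpair P Q H (P.lmap H f a) b :=
  cmap_cmk id (fun H => P.lmap H f) (fun _ => LinearMap.id)
    (fun H H' h a b => by simp [P.lmap_rmap, cmk_rel]) H a b

@[simp]
theorem comp_rmap_cpair {F G G' : C} (g : G ⟶ G') (H : C) (a : P.obj F H) (b : Q.obj H G) :
    (comp P Q).rmap F g (cpair P Q H a b) = cpair P Q H a (Q.rmap H g b) :=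
  cmap_cmk id (fun _ => LinearMap.id) (fun H => Q.rmap H g)
    (fun H H' h a b => by simp [Q.lmap_rmap, cmk_rel]) H a b

@[simp]
theorem comp_str_cpair {F G : C} (K H : C) (a : P.obj F H) (b : Q.obj H G) :
    (comp P Q).str K (cpair P Q H a b) = cpair P Q (K ⊗ H) (P.str K a) (Q.str K b) :=
  cmap_cmk (fun L => K ⊗ L) (fun _ => P.str K) (fun _ => Q.str K)
    (fun L L' h a b => by simp [P.str_rmap, Q.str_lmap, cmk_rel]) H a b

variable {P Q R}

/-- Induction principle for elements of the composite. -/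
theorem comp_ind {F G : C} {p : (comp P Q).obj F G → Prop} (x : (comp P Q).obj F G) (h0 : p 0)
    (hadd : ∀ x y, p x → p y → p (x + y)) (hmk : ∀ H a b, p (cpair P Q H a b)) : p x :=
  Coend.induction k _ _ x h0 hadd hmk

/-- Linear maps out of the composite. -/
def compLift {V : Type*} [AddCommGroup V] [Module k V] {F G : C}
    (f : ∀ H, P.obj F H →ₗ[k] Q.obj H G →ₗ[k] V)
    (hf : ∀ (H H' : C) (h : H ⟶ H') (a : P.obj F H) (b : Q.obj H' G),
      f H' (P.rmap F h a) b = f H a (Q.lmap G h b)) : (comp P Q).obj F G →ₗ[k] V :=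
  clift f hf

@[simp]
theorem compLift_cpair {V : Type*} [AddCommGroup V] [Module k V] {F G : C}
    (f : ∀ H, P.obj F H →ₗ[k] Q.obj H G →ₗ[k] V)
    (hf : ∀ (H H' : C) (h : H ⟶ H') (a : P.obj F H) (b : Q.obj H' G),
      f H' (P.rmap F h a) b = f H a (Q.lmap G h b)) (H : C) (a : P.obj F H) (b : Q.obj H G) :
    compLift f hf (cpair P Q H a b) = f H a b :=
  clift_cmk P Q f hf H a b

theorem comp_ext {V : Type*} [AddCommGroup V] [Module k V] {F G : C}
    {f g : (comp P Q).obj F G →ₗ[k] V}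
    (h : ∀ H a b, f (cpair P Q H a b) = g (cpair P Q H a b)) : f = g :=
  Coend.hom_ext k h

/-- A Tambara morphism out of a composite, from a compatible family of bilinear maps. -/
def compDesc (s : ∀ F H G, P.obj F H →ₗ[k] Q.obj H G →ₗ[k] R.obj F G)
    (hs : ∀ {F G H H' : C} (h : H ⟶ H') (a : P.obj F H) (b : Q.obj H' G),
      s F H' G (P.rmap F h a) b = s F H G a (Q.lmap G h b))
    (hl : ∀ {F F' H G : C} (f : F' ⟶ F) (a : P.obj F H) (b : Q.obj H G),
      s F' H G (P.lmap H f a) b = R.lmap G f (s F H G a b))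
    (hr : ∀ {F H G G' : C} (g : G ⟶ G') (a : P.obj F H) (b : Q.obj H G),
      s F H G' a (Q.rmap H g b) = R.rmap F g (s F H G a b))
    (ht : ∀ (K : C) {F H G : C} (a : P.obj F H) (b : Q.obj H G),
      s (K ⊗ F) (K ⊗ H) (K ⊗ G) (P.str K a) (Q.str K b) = R.str K (s F H G a b)) :
    comp P Q ⟶ R where
  app F G := compLift (fun H => s F H G) (fun _ _ h a b => hs h a b)
  app_lmap {F F' G} f x := by
    induction x using comp_ind with
    | h0 => simp
    | hadd x y hx hy => simp only [map_add, hx, hy]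
    | hmk H a b => rw [comp_lmap_cpair, compLift_cpair, compLift_cpair, hl]
  app_rmap {F G G'} g x := by
    induction x using comp_ind with
    | h0 => simp
    | hadd x y hx hy => simp only [map_add, hx, hy]
    | hmk H a b => rw [comp_rmap_cpair, compLift_cpair, compLift_cpair, hr]
  app_str K {F G} x := by
    induction x using comp_ind with
    | h0 => simp
    | hadd x y hx hy => simp only [map_add, hx, hy]
    | hmk H a b => rw [comp_str_cpair, compLift_cpair, compLift_cpair, ht]

@[simp]
theorem compDesc_app_cpair (s : ∀ F H G, P.obj F H →ₗ[k] Q.obj H G →ₗ[k] R.obj F G)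
    (hs) (hl) (hr) (ht) {F G : C} (H : C) (a : P.obj F H) (b : Q.obj H G) :
    (compDesc s hs hl hr ht).app F G (cpair P Q H a b) = s F H G a b :=
  compLift_cpair _ (fun _ _ h a b => hs h a b) H a b

theorem comp_hom_ext {s t : comp P Q ⟶ R}
    (h : ∀ (F G H : C) (a : P.obj F H) (b : Q.obj H G),
      s.app F G (cpair P Q H a b) = t.app F G (cpair P Q H a b)) : s = t :=
  Hom.ext (by funext F G; exact comp_ext (h F G))

theorem comp_hom_ext₃ {S : TambMod k C} {s t : comp (comp P Q) R ⟶ S}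
    (h : ∀ (F G H L : C) (a : P.obj F H) (b : Q.obj H L) (c : R.obj L G),
      s.app F G (cpair _ R L (cpair P Q H a b) c) = t.app F G (cpair _ R L (cpair P Q H a b) c)) :
    s = t :=
  comp_hom_ext fun F G L x c => by
    induction x using comp_ind with
    | h0 => simp
    | hadd x y hx hy => simp only [map_add, LinearMap.add_apply, hx, hy]
    | hmk H a b => exact h F G H L a b c

theorem comp_hom_ext₄ {S T : TambMod k C} {s t : comp (comp (comp P Q) R) S ⟶ T}
    (h : ∀ (F G H L N : C) (a : P.obj F H) (b : Q.obj H L) (c : R.obj L N) (d : S.obj N G),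
      s.app F G (cpair _ S N (cpair _ R L (cpair P Q H a b) c) d) =
        t.app F G (cpair _ S N (cpair _ R L (cpair P Q H a b) c) d)) :
    s = t :=
  comp_hom_ext₃ fun F G L N x c d => by
    induction x using comp_ind with
    | h0 => simp
    | hadd x y hx hy => simp only [map_add, LinearMap.add_apply, hx, hy]
    | hmk H a b => exact h F G H L N a b c d

end

/-- Horizontal composition of Tambara morphisms. -/
def compMap {P P' Q Q' : TambMod k C} (s : P ⟶ P') (t : Q ⟶ Q') : comp P Q ⟶ comp P' Q' :=
  compDesc (fun F H G => (cpair P' Q' H).compl₁₂ (s.app F H) (t.app H G))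
    (fun h a b => by simp [s.app_rmap, t.app_lmap, cpair_rel])
    (fun f a b => by simp [s.app_lmap])
    (fun f a b => by simp [t.app_rmap])
    (fun K _ _ _ a b => by simp [s.app_str, t.app_str])

@[simp]
theorem compMap_app_cpair {P P' Q Q' : TambMod k C} (s : P ⟶ P') (t : Q ⟶ Q') {F G : C} (H : C)
    (a : P.obj F H) (b : Q.obj H G) :
    (compMap s t).app F G (cpair P Q H a b) = cpair P' Q' H (s.app F H a) (t.app H G b) :=
  compLift_cpair _ (fun _ _ h a b => by simp [s.app_rmap, t.app_lmap, cpair_rel]) H a b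

section

variable (P Q R : TambMod k C)

/-- The map `p ⊗ q ↦ (r ↦ p ⊗ (q ⊗ r))`. -/
def assocAux (F L G : C) :
    (comp P Q).obj F L →ₗ[k] R.obj L G →ₗ[k] (comp P (comp Q R)).obj F G :=
  compLift
    (fun H => LinearMap.mk₂ k (fun a b => (cpair P (comp Q R) H a) ∘ₗ (cpair Q R L b))
      (fun _ _ _ => by ext; simp) (fun _ _ _ => by ext; simp) (fun _ _ _ => by ext; simp)
      (fun _ _ _ => by ext; simp))
    (fun H H' h a b => by ext; simp [cpair_rel])

@[simp]
theorem assocAux_cpair {F L G : C} (H : C) (a : P.obj F H) (b : Q.obj H L) (c : R.obj L G) :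
    assocAux P Q R F L G (cpair P Q H a b) c = cpair P (comp Q R) H a (cpair Q R L b c) := by
  simp [assocAux]

/-- The map `q ⊗ r ↦ (p ⊗ q) ⊗ r`. -/
def assocAux' (F H G : C) :
    P.obj F H →ₗ[k] (comp Q R).obj H G →ₗ[k] (comp (comp P Q) R).obj F G :=
  LinearMap.flip (compLift
    (fun L => LinearMap.mk₂ k
      (fun b c => (((cpair (comp P Q) R L).flip c) ∘ₗ ((cpair P Q H).flip b)))
      (fun _ _ _ => by ext; simp) (fun _ _ _ => by ext; simp) (fun _ _ _ => by ext; simp)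
      (fun _ _ _ => by ext; simp))
    (fun H H' h a b => by ext; simp [← cpair_rel]))

@[simp]
theorem assocAux'_cpair {F H G : C} (L : C) (a : P.obj F H) (b : Q.obj H L) (c : R.obj L G) :
    assocAux' P Q R F H G a (cpair Q R L b c) = cpair (comp P Q) R L (cpair P Q H a b) c := by
  simp [assocAux']

/-- The associator `(p ⊗ q) ⊗ r ↦ p ⊗ (q ⊗ r)` of the composition of Tambara modules. -/
def assoc : comp (comp P Q) R ≅ comp P (comp Q R) :=
  isoMk
    (compDesc (assocAux P Q R)
      (fun h a b => by induction a using comp_ind <;> simp_all [cpair_rel])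
      (fun h a b => by induction a using comp_ind <;> simp_all)
      (fun h a b => by induction a using comp_ind <;> simp_all)
      (fun K _ _ _ a b => by induction a using comp_ind <;> simp_all))
    (fun F G => compLift (fun H => assocAux' P Q R F H G)
      (fun _ _ h a b => by induction b using comp_ind <;> simp_all [cpair_rel]))
    (fun F G x => by
      induction x using comp_ind with
      | h0 => simp
      | hadd x y hx hy => simp only [map_add, hx, hy]
      | hmk L a c => induction a using comp_ind <;> simp_all)
    (fun F G x => by
      induction x using comp_ind with
      | h0 => simp
      | hadd x y hx hy => simp only [map_add, hx, hy]
      | hmk L a c => induction c using comp_ind <;> simp_all)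

@[simp]
theorem assoc_hom_app {F G H L : C} (a : P.obj F H) (b : Q.obj H L) (c : R.obj L G) :
    (assoc P Q R).hom.app F G (cpair _ R L (cpair P Q H a b) c) =
      cpair P _ H a (cpair Q R L b c) := by
  simp [assoc]

end

theorem compMap_id (P Q : TambMod k C) : compMap (𝟙 P) (𝟙 Q) = 𝟙 (comp P Q) :=
  comp_hom_ext fun F G H a b => by simp

theorem compMap_comp {P P' P'' Q Q' Q'' : TambMod k C} (s : P ⟶ P') (t : Q ⟶ Q')
    (s' : P' ⟶ P'') (t' : Q' ⟶ Q'') :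
    compMap (s ≫ s') (t ≫ t') = compMap s t ≫ compMap s' t' :=
  comp_hom_ext fun F G H a b => by simp

/-! ### The monoidal category of Tambara modules -/

section Monoidal

variable [MonoidalPreadditive C] [MonoidalLinear k C]

variable (k C) in
/-- The hom profunctor `C(-, -)` with its Tambara structure `H ⊗ -`. -/
def unit : TambMod k C where
  obj F G := F ⟶ G
  lmap G := LinearMap.mk₂ k (fun f x => f ≫ x) (by simp) (by simp) (by simp) (by simp)
  rmap F := LinearMap.mk₂ k (fun g x => x ≫ g) (by simp) (by simp) (by simp) (by simp)
  lmap_id := by simp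
  lmap_comp := by simp
  rmap_id := by simp
  rmap_comp := by simp
  lmap_rmap := by simp
  str H _ _ :=
    { toFun := fun x => H ◁ x
      map_add' := by simp
      map_smul' := by simp }
  str_lmap := by simp
  str_rmap := by simp
  str_extranatural h F G x := whisker_exchange h x |>.symm
  str_tensor := by simp
  str_unit := by simp

variable (k) in
/-- A morphism as an element of the hom profunctor. -/
def uin {F G : C} : (F ⟶ G) →ₗ[k] (unit k C).obj F G := LinearMap.id

theorem unit_ind {F G : C} {p : (unit k C).obj F G → Prop} (x : (unit k C).obj F G)
    (h : ∀ f : F ⟶ G, p (uin k f)) : p x := h x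

@[simp]
theorem unit_lmap {F F' G : C} (f : F' ⟶ F) (x : F ⟶ G) :
    (unit k C).lmap G f (uin k x) = uin k (f ≫ x) := rfl

@[simp]
theorem unit_rmap {F G G' : C} (g : G ⟶ G') (x : F ⟶ G) :
    (unit k C).rmap F g (uin k x) = uin k (x ≫ g) := rfl

@[simp]
theorem unit_str {F G : C} (H : C) (x : F ⟶ G) : (unit k C).str H (uin k x) = uin k (H ◁ x) := rfl

variable (P Q R : TambMod k C)

/-- The action of the hom profunctor from the left. -/
def lact (F H G : C) : (unit k C).obj F H →ₗ[k] P.obj H G →ₗ[k] P.obj F G := P.lmap G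

/-- The action of the hom profunctor from the right. -/
def ract (F H G : C) : P.obj F H →ₗ[k] (unit k C).obj H G →ₗ[k] P.obj F G := (P.rmap F).flip

@[simp]
theorem lact_uin {F H G : C} (f : F ⟶ H) (x : P.obj H G) :
    lact P F H G (uin k f) x = P.lmap G f x := rfl

@[simp]
theorem ract_uin {F H G : C} (g : H ⟶ G) (x : P.obj F H) :
    ract P F H G x (uin k g) = P.rmap F g x := rfl

/-- The left unitor `f ⊗ p ↦ P(f, G)(p)`. -/
def lUnitor : comp (unit k C) P ≅ P :=
  isoMk
    (compDesc (lact P)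
      (fun h a b => by induction a using unit_ind; simp [P.lmap_comp])
      (fun f a b => by induction a using unit_ind; simp [P.lmap_comp])
      (fun f a b => by induction a using unit_ind; simp [P.lmap_rmap])
      (fun K _ _ _ a b => by induction a using unit_ind; simp [P.str_lmap]))
    (fun F G => cpair (unit k C) P F (uin k (𝟙 F)))
    (fun F G x => by
      induction x using comp_ind with
      | h0 => simp
      | hadd x y hx hy => simp only [map_add, hx, hy]
      | hmk H a b =>
        induction a using unit_ind
        rw [compDesc_app_cpair, lact_uin, ← cpair_rel, unit_rmap, Category.id_comp])
    (fun F G x => by rw [compDesc_app_cpair, lact_uin, P.lmap_id])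

@[simp]
theorem lUnitor_hom_app {F G H : C} (a : (unit k C).obj F H) (b : P.obj H G) :
    (lUnitor P).hom.app F G (cpair (unit k C) P H a b) = lact P F H G a b := by
  simp only [lUnitor, isoMk_hom, compDesc_app_cpair]

/-- The right unitor `p ⊗ g ↦ P(F, g)(p)`. -/
def rUnitor : comp P (unit k C) ≅ P :=
  isoMk
    (compDesc (ract P)
      (fun h a b => by induction b using unit_ind; simp [P.rmap_comp])
      (fun f a b => by induction b using unit_ind; simp [P.lmap_rmap])
      (fun f a b => by induction b using unit_ind; simp [P.rmap_comp])
      (fun K _ _ _ a b => by induction b using unit_ind; simp [P.str_rmap]))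
    (fun F G => (cpair P (unit k C) G).flip (uin k (𝟙 G)))
    (fun F G x => by
      induction x using comp_ind with
      | h0 => simp
      | hadd x y hx hy => simp only [map_add, hx, hy]
      | hmk H a b =>
        induction b using unit_ind
        rw [compDesc_app_cpair, ract_uin, LinearMap.flip_apply, cpair_rel, unit_lmap,
          Category.comp_id])
    (fun F G x => by rw [LinearMap.flip_apply, compDesc_app_cpair, ract_uin, P.rmap_id])

@[simp]
theorem rUnitor_hom_app {F G H : C} (a : P.obj F H) (b : (unit k C).obj H G) :
    (rUnitor P).hom.app F G (cpair P (unit k C) H a b) = ract P F H G a b := by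
  simp only [rUnitor, isoMk_hom, compDesc_app_cpair]

instance : MonoidalCategoryStruct (TambMod k C) where
  tensorObj := comp
  tensorHom s t := compMap s t
  whiskerLeft P _ _ t := compMap (𝟙 P) t
  whiskerRight s Q := compMap s (𝟙 Q)
  tensorUnit := unit k C
  associator := assoc
  leftUnitor := lUnitor
  rightUnitor := rUnitor

/-- The monoidal category of Tambara modules from `C` to `C`, with tensor product `⋄`. -/
instance : MonoidalCategory (TambMod k C) where
  tensorHom_def s t := by
    change compMap s t = compMap s (𝟙 _) ≫ compMap (𝟙 _) t
    rw [← compMap_comp, Category.comp_id, Category.id_comp]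
  id_tensorHom_id P Q := compMap_id P Q
  tensorHom_comp_tensorHom s t s' t' := (compMap_comp s t s' t').symm
  whiskerLeft_id P Q := compMap_id P Q
  id_whiskerRight P Q := compMap_id P Q
  associator_naturality s t r := by
    change compMap (compMap s t) r ≫ (assoc _ _ _).hom =
      (assoc _ _ _).hom ≫ compMap s (compMap t r)
    exact comp_hom_ext₃ fun F G H L a b c => by simp
  leftUnitor_naturality t := by
    change compMap (𝟙 (unit k C)) t ≫ (lUnitor _).hom = (lUnitor _).hom ≫ t
    refine comp_hom_ext fun F G H a b => ?_
    induction a using unit_ind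
    simp [t.app_lmap]
  rightUnitor_naturality t := by
    change compMap t (𝟙 (unit k C)) ≫ (rUnitor _).hom = (rUnitor _).hom ≫ t
    refine comp_hom_ext fun F G H a b => ?_
    induction b using unit_ind
    simp [t.app_rmap]
  pentagon P Q R S := by
    change compMap (assoc P Q R).hom (𝟙 S) ≫ (assoc P (comp Q R) S).hom ≫
        compMap (𝟙 P) (assoc Q R S).hom =
      (assoc (comp P Q) R S).hom ≫ (assoc P Q (comp R S)).hom
    exact comp_hom_ext₄ fun F G H L N a b c d => by simp
  triangle P Q := by
    change (assoc P (unit k C) Q).hom ≫ compMap (𝟙 P) (lUnitor Q).hom =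
      compMap (rUnitor P).hom (𝟙 Q)
    refine comp_hom_ext₃ fun F G H L a b c => ?_
    induction b using unit_ind
    simp [cpair_rel]

end Monoidal

end TambMod

/-! ### Presheaves and Day convolution -/

section Presheaves

variable (k C) in
/-- The presheaf `C(-, 𝟙)` represented by the monoidal unit. -/
def unitPsh : LinPsh k C where
  obj F := F ⟶ 𝟙_ C
  map := LinearMap.mk₂ k (fun f x => f ≫ x) (by simp) (by simp) (by simp) (by simp)
  map_id := by simp
  map_comp := by simp

variable (k) in
/-- A morphism `F ⟶ 𝟙` as an element of the presheaf represented by the monoidal unit. -/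
def rin {F : C} : (F ⟶ 𝟙_ C) →ₗ[k] (unitPsh k C).obj F := LinearMap.id

theorem rin_ind {F : C} {p : (unitPsh k C).obj F → Prop} (x : (unitPsh k C).obj F)
    (h : ∀ f : F ⟶ 𝟙_ C, p (rin k f)) : p x := h x

@[simp]
theorem unitPsh_map {F F' : C} (f : F' ⟶ F) (x : F ⟶ 𝟙_ C) :
    (unitPsh k C).map f (rin k x) = rin k (f ≫ x) := rfl

/-- Composition of morphisms of presheaves. -/
def LinPsh.Hom.comp {P Q R : LinPsh k C} (s : LinPsh.Hom P Q) (t : LinPsh.Hom Q R) :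
    LinPsh.Hom P R where
  app F := t.app F ∘ₗ s.app F
  naturality f x := by simp [s.naturality, t.naturality]

variable (k) in
/-- Covariance of `C(F, H ⊗ K)` in the pair `(H, K)`. -/
def dayL (F : C) {H H' : C × C} (h : H ⟶ H') : (F ⟶ H.1 ⊗ H.2) →ₗ[k] (F ⟶ H'.1 ⊗ H'.2) :=
  Linear.rightComp k F (h.1 ⊗ₘ h.2)

variable (P Q : LinPsh k C)

/-- Contravariance of `P(H) ⊗ Q(K)` in the pair `(H, K)`. -/
def dayR {H H' : C × C} (h : H ⟶ H') :
    P.obj H'.1 ⊗[k] Q.obj H'.2 →ₗ[k] P.obj H.1 ⊗[k] Q.obj H.2 :=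
  TensorProduct.map (P.map h.1) (Q.map h.2)

/-- The value at `F` of the Day convolution,
`(P ∗ Q)(F) = ∫^{(H, K)} C(F, H ⊗ K) ⊗ (P(H) ⊗ Q(K))`. -/
def dayObj (F : C) : Type u :=
  Coend k (J := C × C) (A := fun H => (F ⟶ H.1 ⊗ H.2)) (B := fun H => P.obj H.1 ⊗[k] Q.obj H.2)
    (fun h => dayL k F h) (fun h => dayR P Q h)

instance (F : C) : AddCommGroup (dayObj P Q F) := inferInstanceAs (AddCommGroup (Coend ..))

instance (F : C) : Module k (dayObj P Q F) := inferInstanceAs (Module k (Coend ..))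

/-- The class of `f ⊗ t` in the Day convolution. -/
def dayMk {F : C} (H : C × C) :
    (F ⟶ H.1 ⊗ H.2) →ₗ[k] (P.obj H.1 ⊗[k] Q.obj H.2) →ₗ[k] dayObj P Q F :=
  Coend.mk k (J := C × C) (A := fun H => (F ⟶ H.1 ⊗ H.2))
    (B := fun H => P.obj H.1 ⊗[k] Q.obj H.2) (fun h => dayL k F h) (fun h => dayR P Q h) H

theorem dayMk_rel {F : C} {H H' : C × C} (h : H ⟶ H') (f : F ⟶ H.1 ⊗ H.2)
    (t : P.obj H'.1 ⊗[k] Q.obj H'.2) :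
    dayMk P Q H' (dayL k F h f) t = dayMk P Q H f (dayR P Q h t) :=
  Coend.mk_rel k (J := C × C) (A := fun H => (F ⟶ H.1 ⊗ H.2))
    (B := fun H => P.obj H.1 ⊗[k] Q.obj H.2) (fun h => dayL k F h) (fun h => dayR P Q h) h f t

theorem dayL_leftComp {F F' : C} (f : F' ⟶ F) {H H' : C × C} (h : H ⟶ H')
    (a : F ⟶ H.1 ⊗ H.2) : f ≫ dayL k F h a = dayL k F' h (f ≫ a) := by
  simp [dayL]

variable {P Q} in
/-- Linear maps out of the Day convolution. -/
def dayLift₀ {V : Type*} [AddCommGroup V] [Module k V] {F : C}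
    (s : ∀ H : C × C, (F ⟶ H.1 ⊗ H.2) →ₗ[k] (P.obj H.1 ⊗[k] Q.obj H.2) →ₗ[k] V)
    (hs : ∀ (H H' : C × C) (h : H ⟶ H') (f : F ⟶ H.1 ⊗ H.2) (t : P.obj H'.1 ⊗[k] Q.obj H'.2),
      s H' (dayL k F h f) t = s H f (dayR P Q h t)) : dayObj P Q F →ₗ[k] V :=
  Coend.lift k s hs

theorem dayLift₀_dayMk {V : Type*} [AddCommGroup V] [Module k V] {F : C}
    (s : ∀ H : C × C, (F ⟶ H.1 ⊗ H.2) →ₗ[k] (P.obj H.1 ⊗[k] Q.obj H.2) →ₗ[k] V)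
    (hs : ∀ (H H' : C × C) (h : H ⟶ H') (f : F ⟶ H.1 ⊗ H.2) (t : P.obj H'.1 ⊗[k] Q.obj H'.2),
      s H' (dayL k F h f) t = s H f (dayR P Q h t)) (H : C × C) (f : F ⟶ H.1 ⊗ H.2)
      (t : P.obj H.1 ⊗[k] Q.obj H.2) : dayLift₀ s hs (dayMk P Q H f t) = s H f t :=
  Coend.lift_mk k s hs H f t

/-- The map on the Day convolution induced by precomposition. -/
def dayMap {F F' : C} (f : F' ⟶ F) : dayObj P Q F →ₗ[k] dayObj P Q F' :=
  dayLift₀ (fun H => dayMk P Q H ∘ₗ Linear.leftComp k (H.1 ⊗ H.2) f)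
    (fun _ H' h a b => (congrArg (fun t => dayMk P Q H' t b) (dayL_leftComp f h a)).trans
      (dayMk_rel P Q h (f ≫ a) b))

theorem dayMap_dayMk {F F' : C} (f' : F' ⟶ F) (H : C × C) (f : F ⟶ H.1 ⊗ H.2)
    (t : P.obj H.1 ⊗[k] Q.obj H.2) :
    dayMap P Q f' (dayMk P Q H f t) = dayMk P Q H (f' ≫ f) t :=
  dayLift₀_dayMk P Q _ _ H f t

/-- The class of `f ⊗ (x ⊗ y)` in the Day convolution. -/
def dmk₀ {F : C} (H K : C) :
    (F ⟶ H ⊗ K) →ₗ[k] P.obj H →ₗ[k] Q.obj K →ₗ[k] dayObj P Q F :=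
  LinearMap.mk₂ k (fun f x => dayMk P Q (H, K) f ∘ₗ TensorProduct.mk k (P.obj H) (Q.obj K) x)
    (fun f f' x => by rw [map_add, LinearMap.add_comp])
    (fun r f x => by rw [map_smul, LinearMap.smul_comp])
    (fun f x x' => by rw [map_add, LinearMap.comp_add])
    (fun r f x => by rw [map_smul, LinearMap.comp_smul])

theorem dayMap_dmk₀ {F F' : C} (f' : F' ⟶ F) (H K : C) (f : F ⟶ H ⊗ K) (x : P.obj H)
    (y : Q.obj K) : dayMap P Q f' (dmk₀ P Q H K f x y) = dmk₀ P Q H K (f' ≫ f) x y :=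
  dayMap_dayMk P Q f' (H, K) f (x ⊗ₜ[k] y)

variable {P Q} in
theorem day_ind₀ {F : C} {p : dayObj P Q F → Prop} (x : dayObj P Q F) (h0 : p 0)
    (hadd : ∀ x y, p x → p y → p (x + y)) (hmk : ∀ H K f a b, p (dmk₀ P Q H K f a b)) : p x := by
  refine Coend.induction k _ _ x h0 hadd fun H f t => ?_
  induction t using TensorProduct.induction_on with
  | zero => rw [map_zero]; exact h0
  | add x y hx hy => rw [map_add]; exact hadd _ _ hx hy
  | tmul a b => exact hmk H.1 H.2 f a b

/-- The Day convolution of presheaves. -/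
def day : LinPsh k C where
  obj := dayObj P Q
  map :=
    LinearMap.mk₂ k (fun f x => dayMap P Q f x)
      (fun f f' x => by
        induction x using day_ind₀ with
        | h0 => simp
        | hadd x y hx hy => simp only [map_add, hx, hy]; abel
        | hmk H K f a b => simp only [dayMap_dmk₀, Preadditive.add_comp, map_add, LinearMap.add_apply])
      (fun r f x => by
        induction x using day_ind₀ with
        | h0 => simp
        | hadd x y hx hy => simp only [map_add, hx, hy, smul_add]
        | hmk H K f a b => simp only [dayMap_dmk₀, Linear.smul_comp, map_smul, LinearMap.smul_apply])
      (fun f x y => map_add _ _ _) (fun r f x => map_smul _ _ _)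
  map_id x := by
    induction x using day_ind₀ with
    | h0 => simp
    | hadd x y hx hy => simp only [map_add, hx, hy]
    | hmk H K f a b => simp [dayMap_dmk₀]
  map_comp f f' x := by
    induction x using day_ind₀ with
    | h0 => simp
    | hadd x y hx hy => simp only [map_add, hx, hy]
    | hmk H K f a b => simp [dayMap_dmk₀]

/-- The class of `f ⊗ (x ⊗ y)` in the Day convolution. -/
def dmk {F : C} (H K : C) :
    (F ⟶ H ⊗ K) →ₗ[k] P.obj H →ₗ[k] Q.obj K →ₗ[k] (day P Q).obj F :=
  dmk₀ P Q H K

@[simp]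
theorem day_map_dmk {F F' : C} (f' : F' ⟶ F) (H K : C) (f : F ⟶ H ⊗ K) (x : P.obj H)
    (y : Q.obj K) : (day P Q).map f' (dmk P Q H K f x y) = dmk P Q H K (f' ≫ f) x y :=
  dayMap_dmk₀ P Q f' H K f x y

theorem dmk_rel {F H H' K K' : C} (h : H ⟶ H') (l : K ⟶ K') (f : F ⟶ H ⊗ K) (x : P.obj H')
    (y : Q.obj K') :
    dmk P Q H' K' (f ≫ (h ⊗ₘ l)) x y = dmk P Q H K f (P.map h x) (Q.map l y) :=
  dayMk_rel P Q (H := (H, K)) (H' := (H', K')) (h, l) f (x ⊗ₜ[k] y)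

variable {P Q}

theorem day_ind {F : C} {p : (day P Q).obj F → Prop} (x : (day P Q).obj F) (h0 : p 0)
    (hadd : ∀ x y, p x → p y → p (x + y)) (hmk : ∀ H K f a b, p (dmk P Q H K f a b)) : p x :=
  day_ind₀ x h0 hadd hmk

/-- Linear maps out of the Day convolution. -/
def dayLift {V : Type*} [AddCommGroup V] [Module k V] {F : C}
    (s : ∀ H K, (F ⟶ H ⊗ K) →ₗ[k] P.obj H →ₗ[k] Q.obj K →ₗ[k] V)
    (hs : ∀ {H H' K K' : C} (h : H ⟶ H') (l : K ⟶ K') (f : F ⟶ H ⊗ K) (x : P.obj H')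
      (y : Q.obj K'), s H' K' (f ≫ (h ⊗ₘ l)) x y = s H K f (P.map h x) (Q.map l y)) :
    (day P Q).obj F →ₗ[k] V :=
  dayLift₀
    (fun H => LinearMap.mk₂ k (fun f t => TensorProduct.lift (s H.1 H.2 f) t)
      (fun f f' t => (LinearMap.congr_fun (TensorProduct.ext' fun x y => by simp) t :
        TensorProduct.lift (s H.1 H.2 (f + f')) t =
          (TensorProduct.lift (s H.1 H.2 f) + TensorProduct.lift (s H.1 H.2 f')) t))
      (fun r f t => (LinearMap.congr_fun (TensorProduct.ext' fun x y => by simp) t :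
        TensorProduct.lift (s H.1 H.2 (r • f)) t = (r • TensorProduct.lift (s H.1 H.2 f)) t))
      (fun _ _ _ => map_add _ _ _) (fun _ _ _ => map_smul _ _ _))
    (fun H H' h f t => by
      induction t using TensorProduct.induction_on with
      | zero => rw [map_zero, map_zero, map_zero]
      | add x y hx hy => rw [map_add, map_add, map_add, hx, hy]
      | tmul x y => exact hs h.1 h.2 f x y)

@[simp]
theorem dayLift_dmk {V : Type*} [AddCommGroup V] [Module k V] {F : C}
    (s : ∀ H K, (F ⟶ H ⊗ K) →ₗ[k] P.obj H →ₗ[k] Q.obj K →ₗ[k] V)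
    (hs : ∀ {H H' K K' : C} (h : H ⟶ H') (l : K ⟶ K') (f : F ⟶ H ⊗ K) (x : P.obj H')
      (y : Q.obj K'), s H' K' (f ≫ (h ⊗ₘ l)) x y = s H K f (P.map h x) (Q.map l y))
    (H K : C) (f : F ⟶ H ⊗ K) (x : P.obj H) (y : Q.obj K) :
    dayLift s hs (dmk P Q H K f x y) = s H K f x y :=
  dayLift₀_dayMk P Q _ _ (H, K) f (x ⊗ₜ[k] y)

end Presheaves

namespace TambMod

/-! ### The Tambara modules `𝕎(P)` -/

section W

section

variable (P : LinPsh k C)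

/-- `𝕎(P)(F, G) = ∫^H C(F, G ⊗ H) ⊗ P(H)`. -/
def wObj (F G : C) : Type u :=
  Coend k (J := C) (A := fun H => (F ⟶ G ⊗ H)) (B := fun H => P.obj H)
    (fun h => Linear.rightComp k F (G ◁ h)) (fun h => P.map h)

instance (F G : C) : AddCommGroup (wObj P F G) := inferInstanceAs (AddCommGroup (Coend ..))

instance (F G : C) : Module k (wObj P F G) := inferInstanceAs (Module k (Coend ..))

/-- The class of `f ⊗ x` in `𝕎(P)`. -/
def wmk₀ {F G : C} (H : C) : (F ⟶ G ⊗ H) →ₗ[k] P.obj H →ₗ[k] wObj P F G :=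
  Coend.mk k (J := C) (A := fun H => (F ⟶ G ⊗ H)) (B := fun H => P.obj H)
    (fun h => Linear.rightComp k F (G ◁ h)) (fun h => P.map h) H

theorem wmk₀_rel {F G H H' : C} (h : H ⟶ H') (f : F ⟶ G ⊗ H) (x : P.obj H') :
    wmk₀ P H' (f ≫ G ◁ h) x = wmk₀ P H f (P.map h x) :=
  Coend.mk_rel k (J := C) (A := fun H => (F ⟶ G ⊗ H)) (B := fun H => P.obj H)
    (fun h => Linear.rightComp k F (G ◁ h)) (fun h => P.map h) h f x

variable {P}

theorem w_ind₀ {F G : C} {p : wObj P F G → Prop} (x : wObj P F G) (h0 : p 0)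
    (hadd : ∀ x y, p x → p y → p (x + y)) (hmk : ∀ H f a, p (wmk₀ P H f a)) : p x :=
  Coend.induction k _ _ x h0 hadd hmk

/-- Linear maps out of `𝕎(P)(F, G)`. -/
def wLift₀ {V : Type*} [AddCommGroup V] [Module k V] {F G : C}
    (s : ∀ H, (F ⟶ G ⊗ H) →ₗ[k] P.obj H →ₗ[k] V)
    (hs : ∀ (H H' : C) (h : H ⟶ H') (f : F ⟶ G ⊗ H) (x : P.obj H'),
      s H' (f ≫ G ◁ h) x = s H f (P.map h x)) : wObj P F G →ₗ[k] V :=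
  Coend.lift k s hs

@[simp]
theorem wLift₀_wmk₀ {V : Type*} [AddCommGroup V] [Module k V] {F G : C}
    (s : ∀ H, (F ⟶ G ⊗ H) →ₗ[k] P.obj H →ₗ[k] V)
    (hs : ∀ (H H' : C) (h : H ⟶ H') (f : F ⟶ G ⊗ H) (x : P.obj H'),
      s H' (f ≫ G ◁ h) x = s H f (P.map h x)) (H : C) (f : F ⟶ G ⊗ H) (x : P.obj H) :
    wLift₀ s hs (wmk₀ P H f x) = s H f x :=
  Coend.lift_mk k s hs H f x

theorem w_ext₀ {V : Type*} [AddCommGroup V] [Module k V] {F G : C} {s t : wObj P F G →ₗ[k] V}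
    (h : ∀ H f x, s (wmk₀ P H f x) = t (wmk₀ P H f x)) : s = t :=
  Coend.hom_ext k h

variable [MonoidalPreadditive C] [MonoidalLinear k C]

/-- Precomposition on `𝕎(P)`. -/
def wl {F F' : C} (G : C) (f : F' ⟶ F) : wObj P F G →ₗ[k] wObj P F' G :=
  wLift₀ (fun H => wmk₀ P H ∘ₗ Linear.leftComp k (G ⊗ H) f)
    (fun H H' h a b => by simp [← wmk₀_rel])

@[simp]
theorem wl_wmk₀ {F F' G : C} (f' : F' ⟶ F) (H : C) (f : F ⟶ G ⊗ H) (x : P.obj H) :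
    wl G f' (wmk₀ P H f x) = wmk₀ P H (f' ≫ f) x := by
  simp [wl]

/-- Postcomposition on `𝕎(P)`. -/
def wr (F : C) {G G' : C} (g : G ⟶ G') : wObj P F G →ₗ[k] wObj P F G' :=
  wLift₀ (fun H => wmk₀ P H ∘ₗ Linear.rightComp k F (g ▷ H))
    (fun H H' h a b => by simp [← wmk₀_rel, whisker_exchange])

@[simp]
theorem wr_wmk₀ {F G G' : C} (g : G ⟶ G') (H : C) (f : F ⟶ G ⊗ H) (x : P.obj H) :
    wr F g (wmk₀ P H f x) = wmk₀ P H (f ≫ g ▷ H) x := by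
  simp [wr]

/-- The Tambara structure on `𝕎(P)`. -/
def ws (K : C) {F G : C} : wObj P F G →ₗ[k] wObj P (K ⊗ F) (K ⊗ G) :=
  wLift₀ (fun H => LinearMap.mk₂ k (fun f x => wmk₀ P H (K ◁ f ≫ (α_ K G H).inv) x) (by simp)
      (by simp) (by simp) (by simp))
    (fun L L' h a b => by simp [← wmk₀_rel])

@[simp]
theorem ws_wmk₀ {F G : C} (K H : C) (f : F ⟶ G ⊗ H) (x : P.obj H) :
    ws K (wmk₀ P H f x) = wmk₀ P H (K ◁ f ≫ (α_ K G H).inv) x := by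
  simp [ws]

/-- The Tambara module `𝕎(P)`, with Tambara structure
`f ⊗ x ↦ (α⁻¹ ∘ (K ◁ f)) ⊗ x`. -/
def W (P : LinPsh k C) : TambMod k C where
  obj := wObj P
  lmap G :=
    { toFun := fun f => wl G f
      map_add' := fun f f' => w_ext₀ fun H a b => by simp
      map_smul' := fun r f => w_ext₀ fun H a b => by simp }
  rmap F :=
    { toFun := fun g => wr F g
      map_add' := fun f f' => w_ext₀ fun H a b => by simp
      map_smul' := fun r f => w_ext₀ fun H a b => by simp }
  lmap_id x := by induction x using w_ind₀ <;> simp_all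
  lmap_comp f f' x := by induction x using w_ind₀ <;> simp_all
  rmap_id x := by induction x using w_ind₀ <;> simp_all
  rmap_comp f f' x := by induction x using w_ind₀ <;> simp_all
  lmap_rmap f g x := by induction x using w_ind₀ <;> simp_all
  str K := ws K
  str_lmap H _ _ _ f x := by induction x using w_ind₀ <;> simp_all
  str_rmap H _ _ _ f x := by induction x using w_ind₀ <;> simp_all
  str_extranatural h F G x := by
    induction x using w_ind₀ with
    | h0 => simp
    | hadd x y hx hy => simp_all
    | hmk L a b => simp [← whisker_exchange_assoc]
  str_tensor K H F G x := by
    induction x using w_ind₀ with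
    | h0 => simp
    | hadd x y hx hy => simp_all
    | hmk L a b => simp
  str_unit {F G} x := by
    induction x using w_ind₀ with
    | h0 => simp
    | hadd x y hx hy => simp_all
    | hmk L a b => simp

/-- The class of `f ⊗ x` in `𝕎(P)(F, G)`. -/
def wmk (P : LinPsh k C) {F G : C} (H : C) :
    (F ⟶ G ⊗ H) →ₗ[k] P.obj H →ₗ[k] (W P).obj F G :=
  wmk₀ P H

theorem wmk_rel {F G H H' : C} (h : H ⟶ H') (f : F ⟶ G ⊗ H) (x : P.obj H') :
    wmk P H' (f ≫ G ◁ h) x = wmk P H f (P.map h x) :=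
  wmk₀_rel P h f x

@[simp]
theorem W_lmap_wmk {F F' G : C} (f' : F' ⟶ F) (H : C) (f : F ⟶ G ⊗ H) (x : P.obj H) :
    (W P).lmap G f' (wmk P H f x) = wmk P H (f' ≫ f) x :=
  wl_wmk₀ f' H f x

@[simp]
theorem W_rmap_wmk {F G G' : C} (g : G ⟶ G') (H : C) (f : F ⟶ G ⊗ H) (x : P.obj H) :
    (W P).rmap F g (wmk P H f x) = wmk P H (f ≫ g ▷ H) x :=
  wr_wmk₀ g H f x

@[simp]
theorem W_str_wmk {F G : C} (K H : C) (f : F ⟶ G ⊗ H) (x : P.obj H) :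
    (W P).str K (wmk P H f x) = wmk P H (K ◁ f ≫ (α_ K G H).inv) x :=
  ws_wmk₀ K H f x

theorem w_ind {F G : C} {p : (W P).obj F G → Prop} (x : (W P).obj F G) (h0 : p 0)
    (hadd : ∀ x y, p x → p y → p (x + y)) (hmk : ∀ H f a, p (wmk P H f a)) : p x :=
  w_ind₀ x h0 hadd hmk

/-- Linear maps out of `𝕎(P)(F, G)`. -/
def wLift {V : Type*} [AddCommGroup V] [Module k V] {F G : C}
    (s : ∀ H, (F ⟶ G ⊗ H) →ₗ[k] P.obj H →ₗ[k] V)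
    (hs : ∀ (H H' : C) (h : H ⟶ H') (f : F ⟶ G ⊗ H) (x : P.obj H'),
      s H' (f ≫ G ◁ h) x = s H f (P.map h x)) : (W P).obj F G →ₗ[k] V :=
  wLift₀ s hs

@[simp]
theorem wLift_wmk {V : Type*} [AddCommGroup V] [Module k V] {F G : C}
    (s : ∀ H, (F ⟶ G ⊗ H) →ₗ[k] P.obj H →ₗ[k] V)
    (hs : ∀ (H H' : C) (h : H ⟶ H') (f : F ⟶ G ⊗ H) (x : P.obj H'),
      s H' (f ≫ G ◁ h) x = s H f (P.map h x)) (H : C) (f : F ⟶ G ⊗ H) (x : P.obj H) :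
    wLift s hs (wmk P H f x) = s H f x :=
  wLift₀_wmk₀ s hs H f x

theorem w_ext {V : Type*} [AddCommGroup V] [Module k V] {F G : C} {s t : (W P).obj F G →ₗ[k] V}
    (h : ∀ H f x, s (wmk P H f x) = t (wmk P H f x)) : s = t :=
  Coend.hom_ext k h

theorem w_hom_ext {Q : TambMod k C} {s t : W P ⟶ Q}
    (h : ∀ F G H (f : F ⟶ G ⊗ H) x, s.app F G (wmk P H f x) = t.app F G (wmk P H f x)) : s = t :=
  Hom.ext (by funext F G; exact w_ext (h F G))

/-- The action of `𝕎` on morphisms of presheaves. -/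
def W.map {P Q : LinPsh k C} (s : LinPsh.Hom P Q) : W P ⟶ W Q where
  app F G := wLift (fun H => (wmk Q H).compl₂ (s.app H))
    (fun H H' h f x => by simp [wmk_rel, s.naturality])
  app_lmap f x := by induction x using w_ind <;> simp_all
  app_rmap f x := by induction x using w_ind <;> simp_all
  app_str K _ _ x := by induction x using w_ind <;> simp_all

@[simp]
theorem W_map_app_wmk {P Q : LinPsh k C} (s : LinPsh.Hom P Q) {F G : C} (H : C)
    (f : F ⟶ G ⊗ H) (x : P.obj H) :
    (W.map s).app F G (wmk P H f x) = wmk Q H f (s.app H x) := by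
  simp [W.map]

end

variable [MonoidalPreadditive C] [MonoidalLinear k C]

variable (P Q : LinPsh k C)

/-- The map `(f ⊗ x) ⊗ (g ⊗ y) ↦ (α ∘ (g ▷ H) ∘ f) ⊗ [𝟙 ⊗ (y ⊗ x)]`. -/
def wmuAux (F L G : C) :
    (W P).obj F L →ₗ[k] (W Q).obj L G →ₗ[k] (W (day Q P)).obj F G :=
  wLift
    (fun H => LinearMap.mk₂ k
      (fun f x => wLift
        (fun K => LinearMap.mk₂ k
          (fun g y => wmk (day Q P) (K ⊗ H) (f ≫ g ▷ H ≫ (α_ G K H).hom)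
            (dmk Q P K H (𝟙 (K ⊗ H)) y x))
          (by simp) (by simp) (by simp) (by simp))
        (fun K K' h g y => by
          have := dmk_rel Q P h (𝟙 H) (𝟙 (K ⊗ H)) y x
          rw [P.map_id, tensorHom_id, Category.id_comp] at this
          simp only [LinearMap.mk₂_apply]
          rw [← this, ← Category.comp_id (h ▷ H), ← day_map_dmk, ← wmk_rel]
          simp))
      (fun _ _ _ => w_ext fun _ _ _ => by simp) (fun _ _ _ => w_ext fun _ _ _ => by simp)
      (fun _ _ _ => w_ext fun _ _ _ => by simp) (fun _ _ _ => w_ext fun _ _ _ => by simp))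
    (fun H H' h f x => w_ext fun K g y => by
      have := dmk_rel Q P (𝟙 K) h (𝟙 (K ⊗ H)) y x
      rw [Q.map_id, id_tensorHom, Category.id_comp] at this
      simp only [LinearMap.mk₂_apply, wLift_wmk]
      rw [← this, ← Category.comp_id (K ◁ h), ← day_map_dmk, ← wmk_rel]
      simp [whisker_exchange_assoc])

@[simp]
theorem wmuAux_wmk {F L G : C} (H K : C) (f : F ⟶ L ⊗ H) (x : P.obj H) (g : L ⟶ G ⊗ K)
    (y : Q.obj K) :
    wmuAux P Q F L G (wmk P H f x) (wmk Q K g y) =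
      wmk (day Q P) (K ⊗ H) (f ≫ g ▷ H ≫ (α_ G K H).hom) (dmk Q P K H (𝟙 (K ⊗ H)) y x) := by
  simp [wmuAux]

/-- The structure morphism `𝕎(P) ⋄ 𝕎(Q) ⟶ 𝕎(Q ∗ P)`. -/
def wmu : comp (W P) (W Q) ⟶ W (day Q P) :=
  compDesc (wmuAux P Q)
    (fun h a b => by
      induction a using w_ind <;> induction b using w_ind <;> simp_all)
    (fun h a b => by
      induction a using w_ind <;> induction b using w_ind <;> simp_all)
    (fun h a b => by
      induction a using w_ind <;> induction b using w_ind <;> simp_all)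
    (fun K _ _ _ a b => by
      induction a using w_ind <;> induction b using w_ind <;> simp_all)

@[simp]
theorem wmu_app_cpair {F L G : C} (H K : C) (f : F ⟶ L ⊗ H) (x : P.obj H) (g : L ⟶ G ⊗ K)
    (y : Q.obj K) :
    (wmu P Q).app F G (cpair (W P) (W Q) L (wmk P H f x) (wmk Q K g y)) =
      wmk (day Q P) (K ⊗ H) (f ≫ g ▷ H ≫ (α_ G K H).hom) (dmk Q P K H (𝟙 (K ⊗ H)) y x) := by
  simp [wmu]

variable (k) in
/-- The map `f ↦ (ρ⁻¹ ∘ f) ⊗ 𝟙`. -/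
def wepsAux (F G : C) : (unit k C).obj F G →ₗ[k] (W (unitPsh k C)).obj F G :=
  (wmk (unitPsh k C) (𝟙_ C)).flip (rin k (𝟙 (𝟙_ C))) ∘ₗ Linear.rightComp k F (ρ_ G).inv

@[simp]
theorem wepsAux_uin {F G : C} (f : F ⟶ G) :
    wepsAux k F G (uin k f) =
      wmk (unitPsh k C) (𝟙_ C) (f ≫ (ρ_ G).inv) (rin k (𝟙 (𝟙_ C))) := rfl

variable (k C) in
/-- The structure morphism `C(-, -) ⟶ 𝕎(C(-, 𝟙))`, `f ↦ (ρ⁻¹ ∘ f) ⊗ 𝟙`. -/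
def weps : unit k C ⟶ W (unitPsh k C) where
  app F G := wepsAux k F G
  app_lmap f x := by induction x using unit_ind; simp
  app_rmap g x := by induction x using unit_ind; simp
  app_str K _ _ x := by induction x using unit_ind; simp

@[simp]
theorem weps_app_uin {F G : C} (f : F ⟶ G) :
    (weps k C).app F G (uin k f) =
      wmk (unitPsh k C) (𝟙_ C) (f ≫ (ρ_ G).inv) (rin k (𝟙 (𝟙_ C))) := rfl

end W

end TambMod

/-! ### Presheaves and Tambara modules of a module category -/

section Action

variable {M : Type v} [Category.{u} M] [Preadditive M] [Linear k M] [MonoidalLeftAction C M]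

theorem act_extranatural {H H' F G : C} {X Y : M} (h : H ⟶ H') (x : F ⊙ₗ X ⟶ G ⊙ₗ Y) :
    (h ▷ F) ⊵ₗ X ≫ (αₗ H' F X).hom ≫ H' ⊴ₗ x ≫ (αₗ H' G Y).inv =
      (αₗ H F X).hom ≫ H ⊴ₗ x ≫ (αₗ H G Y).inv ≫ (h ▷ G) ⊵ₗ Y := by
  have e := action_exchange h x
  rw [actionHomLeft_action, actionHomLeft_action] at e
  rw [← cancel_epi (αₗ H F X).inv, ← cancel_mono (αₗ H' G Y).hom]
  simpa using e.symm

theorem associator_inv_act (K H G : C) (Y : M) :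
    K ⊴ₗ (αₗ H G Y).inv ≫ (αₗ K (H ⊗ G) Y).inv ≫ (α_ K H G).inv ⊵ₗ Y =
      (αₗ K H (G ⊙ₗ Y)).inv ≫ (αₗ (K ⊗ H) G Y).inv := by
  have e : inv ((α_ K H G).hom ⊵ₗ Y ≫ (αₗ K (H ⊗ G) Y).hom ≫ K ⊴ₗ (αₗ H G Y).hom) =
      inv ((αₗ (K ⊗ H) G Y).hom ≫ (αₗ K H (G ⊙ₗ Y)).hom) := by
    simp only [associator_actionHom]
  simpa only [IsIso.inv_comp, IsIso.Iso.inv_hom, inv_actionHomLeft, inv_actionHomRight,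
    Category.assoc] using e

theorem associator_act_inv (K H F : C) (X : M) {Z : M} (z : K ⊙ₗ H ⊙ₗ F ⊙ₗ X ⟶ Z) :
    (α_ K H F).inv ⊵ₗ X ≫ (αₗ (K ⊗ H) F X).hom ≫ (αₗ K H (F ⊙ₗ X)).hom ≫ z =
      (αₗ K (H ⊗ F) X).hom ≫ K ⊴ₗ (αₗ H F X).hom ≫ z := by
  rw [← associator_actionHom_assoc, inv_hom_actionHomLeft_assoc]

variable [IsLinearAction k C M]

variable (k) in
/-- The action of morphisms of `C` on an object of `M` as a linear map. -/
def actL {F G : C} (X : M) : (F ⟶ G) →ₗ[k] (F ⊙ₗ X ⟶ G ⊙ₗ X) where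
  toFun f := f ⊵ₗ X
  map_add' f g := IsLinearAction.add_actionHomLeft k f g X
  map_smul' r f := IsLinearAction.smul_actionHomLeft r f X

variable (k) in
/-- The action of an object of `C` on morphisms of `M` as a linear map. -/
def actR (F : C) {X Y : M} : (X ⟶ Y) →ₗ[k] (F ⊙ₗ X ⟶ F ⊙ₗ Y) where
  toFun f := F ⊴ₗ f
  map_add' f g := IsLinearAction.actionHomRight_add k F f g
  map_smul' r f := IsLinearAction.actionHomRight_smul F r f

variable (k C) in
/-- The presheaf `Hom(- X, Y)`, `H ↦ M(H X, Y)`. -/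
def homPsh (X Y : M) : LinPsh k C where
  obj H := H ⊙ₗ X ⟶ Y
  map {H H'} := LinearMap.mk₂ k (fun h b => actL k X h ≫ b)
    (by simp) (by simp) (by simp) (by simp)
  map_id := by simp [actL]
  map_comp := by simp [actL]

variable (k) in
/-- A morphism `H X ⟶ Y` as an element of `Hom(- X, Y)`. -/
def hin {H : C} {X Y : M} : (H ⊙ₗ X ⟶ Y) →ₗ[k] (homPsh k C X Y).obj H := LinearMap.id

/-- An element of `Hom(- X, Y)` as a morphism `H X ⟶ Y`. -/
def hout {H : C} {X Y : M} : (homPsh k C X Y).obj H →ₗ[k] (H ⊙ₗ X ⟶ Y) := LinearMap.id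

@[simp]
theorem hout_hin {H : C} {X Y : M} (b : H ⊙ₗ X ⟶ Y) : hout (hin k b) = b := rfl

theorem h_ind {H : C} {X Y : M} {p : (homPsh k C X Y).obj H → Prop} (x : (homPsh k C X Y).obj H)
    (h : ∀ b : H ⊙ₗ X ⟶ Y, p (hin k b)) : p x := h x

@[simp]
theorem homPsh_map {H H' : C} {X Y : M} (h : H' ⟶ H) (b : H ⊙ₗ X ⟶ Y) :
    (homPsh k C X Y).map h (hin k b) = hin k (h ⊵ₗ X ≫ b) := rfl

variable (k C) in
/-- The hom Tambara module `[X, Y]`, `[X, Y](F, G) = M(F X, G Y)`. -/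
def homTamb (X Y : M) : TambMod k C where
  obj F G := F ⊙ₗ X ⟶ G ⊙ₗ Y
  lmap G := LinearMap.mk₂ k (fun f x => actL k X f ≫ x) (by simp) (by simp) (by simp) (by simp)
  rmap F := LinearMap.mk₂ k (fun g x => x ≫ actL k Y g) (by simp) (by simp) (by simp) (by simp)
  lmap_id := by simp [actL]
  lmap_comp := by simp [actL]
  rmap_id := by simp [actL]
  rmap_comp := by simp [actL]
  lmap_rmap := by simp
  str H F G :=
    { toFun := fun x => (αₗ H F X).hom ≫ actR k H x ≫ (αₗ H G Y).inv
      map_add' := by simp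
      map_smul' := by simp }
  str_lmap := by simp [actL, actR]
  str_rmap := by simp [actL, actR]
  str_extranatural h F G x := by
    simpa [actL, actR] using act_extranatural h x
  str_tensor K H F G x := by
    simp [actL, actR, associator_inv_act, associator_act_inv]
  str_unit {F G} x := by
    simp only [LinearMap.coe_mk, AddHom.coe_mk, LinearMap.mk₂_apply, actL, actR,
      unit_actionHomRight, Category.assoc, leftUnitor_actionHom, Iso.inv_hom_id_assoc,
      Iso.inv_hom_id, Category.comp_id]
    rw [← leftUnitor_actionHom_assoc, inv_hom_actionHomLeft_assoc]

variable (k) in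
/-- A morphism `F X ⟶ G Y` as an element of `[X, Y](F, G)`. -/
def tin {F G : C} {X Y : M} : (F ⊙ₗ X ⟶ G ⊙ₗ Y) →ₗ[k] (homTamb k C X Y).obj F G := LinearMap.id

/-- An element of `[X, Y](F, G)` as a morphism `F X ⟶ G Y`. -/
def tout {F G : C} {X Y : M} : (homTamb k C X Y).obj F G →ₗ[k] (F ⊙ₗ X ⟶ G ⊙ₗ Y) := LinearMap.id

@[simp]
theorem tout_tin {F G : C} {X Y : M} (b : F ⊙ₗ X ⟶ G ⊙ₗ Y) : tout (tin k b) = b := rfl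

theorem t_ind {F G : C} {X Y : M} {p : (homTamb k C X Y).obj F G → Prop}
    (x : (homTamb k C X Y).obj F G) (h : ∀ b : F ⊙ₗ X ⟶ G ⊙ₗ Y, p (tin k b)) : p x := h x

@[simp]
theorem homTamb_lmap {F F' G : C} {X Y : M} (f : F' ⟶ F) (b : F ⊙ₗ X ⟶ G ⊙ₗ Y) :
    (homTamb k C X Y).lmap G f (tin k b) = tin k (f ⊵ₗ X ≫ b) := rfl

@[simp]
theorem homTamb_rmap {F G G' : C} {X Y : M} (g : G ⟶ G') (b : F ⊙ₗ X ⟶ G ⊙ₗ Y) :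
    (homTamb k C X Y).rmap F g (tin k b) = tin k (b ≫ g ⊵ₗ Y) := rfl

@[simp]
theorem homTamb_str {F G : C} {X Y : M} (H : C) (b : F ⊙ₗ X ⟶ G ⊙ₗ Y) :
    (homTamb k C X Y).str H (tin k b) =
      tin k ((αₗ H F X).hom ≫ H ⊴ₗ b ≫ (αₗ H G Y).inv) := rfl

/-- The trilinear map `f ⊗ (b ⊗ c) ↦ b ∘ H c ∘ α ∘ f X`. -/
def compPshAux (X Y Z : M) {F : C} (H K : C) : (F ⟶ H ⊗ K) →ₗ[k]
    (homPsh k C Y Z).obj H →ₗ[k] (homPsh k C X Y).obj K →ₗ[k] (homPsh k C X Z).obj F :=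
  LinearMap.mk₂ k
    (fun f b =>
      { toFun := fun c => hin k (actL k X f ≫ (αₗ H K X).hom ≫ actR k H (hout c) ≫ hout b)
        map_add' := by simp
        map_smul' := by simp })
    (fun _ _ _ => by ext; simp) (fun _ _ _ => by ext; simp)
    (fun _ _ _ => by ext; simp) (fun _ _ _ => by ext; simp)

@[simp]
theorem compPshAux_apply {X Y Z : M} {F H K : C} (f : F ⟶ H ⊗ K) (b : H ⊙ₗ Y ⟶ Z)
    (c : K ⊙ₗ X ⟶ Y) : compPshAux X Y Z H K f (hin k b) (hin k c) =
      hin k (f ⊵ₗ X ≫ (αₗ H K X).hom ≫ H ⊴ₗ c ≫ b) := rfl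

theorem act_tensorHom {H H' K K' : C} {X Y : M} (h : H ⟶ H') (l : K ⟶ K') (c : K' ⊙ₗ X ⟶ Y) :
    (h ⊗ₘ l) ⊵ₗ X ≫ (αₗ H' K' X).hom ≫ H' ⊴ₗ c =
      (αₗ H K X).hom ≫ H ⊴ₗ l ⊵ₗ X ≫ H ⊴ₗ c ≫ h ⊵ₗ Y := by
  have e := actionAssocIso_hom_naturality h l (𝟙 X)
  rw [actionHom_id, actionHom_id, actionHom_def'] at e
  rw [reassoc_of% e, action_exchange]

theorem compPshAux_rel {X Y Z : M} {F H H' K K' : C} (h : H ⟶ H') (l : K ⟶ K') (f : F ⟶ H ⊗ K)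
    (b : (homPsh k C Y Z).obj H') (c : (homPsh k C X Y).obj K') :
    compPshAux X Y Z H' K' (f ≫ (h ⊗ₘ l)) b c =
      compPshAux X Y Z H K f ((homPsh k C Y Z).map h b) ((homPsh k C X Y).map l c) := by
  induction b using h_ind
  induction c using h_ind
  rename_i b c
  have e := act_tensorHom h l c
  simp only [homPsh_map, compPshAux_apply, comp_actionHomLeft, Category.assoc,
    actionHomRight_comp]
  rw [reassoc_of% e]

variable (k C) in
/-- The composition morphism `Hom(- Y, Z) ∗ Hom(- X, Y) ⟶ Hom(- X, Z)`. -/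
def compPsh (X Y Z : M) :
    LinPsh.Hom (day (homPsh k C Y Z) (homPsh k C X Y)) (homPsh k C X Z) where
  app F := dayLift (fun H K => compPshAux X Y Z H K)
    (fun h l f b c => compPshAux_rel h l f b c)
  naturality f x := by
    induction x using day_ind with
    | h0 => simp
    | hadd x y hx hy => simp only [map_add, hx, hy]
    | hmk H K f' a b =>
      induction a using h_ind
      induction b using h_ind
      simp

@[simp]
theorem compPsh_app_dmk {X Y Z : M} {F H K : C} (f : F ⟶ H ⊗ K) (b : H ⊙ₗ Y ⟶ Z)
    (c : K ⊙ₗ X ⟶ Y) : (compPsh k C X Y Z).app F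
      (dmk (homPsh k C Y Z) (homPsh k C X Y) H K f (hin k b) (hin k c)) =
        hin k (f ⊵ₗ X ≫ (αₗ H K X).hom ≫ H ⊴ₗ c ≫ b) := by
  exact (dayLift_dmk (fun H K => compPshAux X Y Z H K)
    (fun h l f b c => compPshAux_rel h l f b c) H K f (hin k b) (hin k c)).trans
      (compPshAux_apply f b c)

/-- The map `f ↦ f X`, followed by the unit isomorphism. -/
def unitPshAux (X : M) (F : C) : (unitPsh k C).obj F →ₗ[k] (homPsh k C X X).obj F :=
  hin k ∘ₗ Linear.rightComp k (F ⊙ₗ X) (λₗ[C] X).hom ∘ₗ actL k X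

@[simp]
theorem unitPshAux_rin (X : M) {F : C} (f : F ⟶ 𝟙_ C) :
    unitPshAux X F (rin k f) = hin k (f ⊵ₗ X ≫ (λₗ X).hom) := rfl

variable (k C) in
/-- The unit morphism `C(-, 𝟙) ⟶ Hom(- X, X)`. -/
def onePsh (X : M) : LinPsh.Hom (unitPsh k C) (homPsh k C X X) where
  app F := unitPshAux X F
  naturality f x := by
    induction x using rin_ind
    simp

@[simp]
theorem onePsh_app_rin (X : M) {F : C} (f : F ⟶ 𝟙_ C) :
    (onePsh k C X).app F (rin k f) = hin k (f ⊵ₗ X ≫ (λₗ X).hom) := rfl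

end Action

namespace TambMod

section Monoids

variable [MonoidalPreadditive C] [MonoidalLinear k C]
variable {M : Type v} [Category.{u} M] [Preadditive M] [Linear k M] [MonoidalLeftAction C M]
  [IsLinearAction k C M]

/-! ### Composition of hom Tambara modules -/

/-- The bilinear map `b ⊗ c ↦ c ∘ b`. -/
def tmulAux (X Y Z : M) (F H G : C) :
    (homTamb k C X Y).obj F H →ₗ[k] (homTamb k C Y Z).obj H G →ₗ[k] (homTamb k C X Z).obj F G :=
  LinearMap.mk₂ k (fun b c => tin k (tout b ≫ tout c)) (by simp) (by simp) (by simp) (by simp)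

@[simp]
theorem tmulAux_apply {X Y Z : M} {F H G : C} (b : F ⊙ₗ X ⟶ H ⊙ₗ Y) (c : H ⊙ₗ Y ⟶ G ⊙ₗ Z) :
    tmulAux X Y Z F H G (tin k b) (tin k c) = tin k (b ≫ c) := rfl

variable (k C) in
/-- The composition morphism `[X, Y] ⋄ [Y, Z] ⟶ [X, Z]`. -/
def tmul (X Y Z : M) : comp (homTamb k C X Y) (homTamb k C Y Z) ⟶ homTamb k C X Z :=
  compDesc (tmulAux X Y Z)
    (fun h a b => by induction a using t_ind; induction b using t_ind; simp)
    (fun h a b => by induction a using t_ind; induction b using t_ind; simp)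
    (fun h a b => by induction a using t_ind; induction b using t_ind; simp)
    (fun K _ _ _ a b => by induction a using t_ind; induction b using t_ind; simp)

@[simp]
theorem tmul_app_cpair {X Y Z : M} {F H G : C} (b : F ⊙ₗ X ⟶ H ⊙ₗ Y) (c : H ⊙ₗ Y ⟶ G ⊙ₗ Z) :
    (tmul k C X Y Z).app F G (cpair _ _ H (tin k b) (tin k c)) = tin k (b ≫ c) := by
  rw [tmul, compDesc_app_cpair, tmulAux_apply]

/-- The map `f ↦ f X`. -/
def toneAux (X : M) (F G : C) : (unit k C).obj F G →ₗ[k] (homTamb k C X X).obj F G :=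
  tin k ∘ₗ actL k X

@[simp]
theorem toneAux_uin (X : M) {F G : C} (f : F ⟶ G) :
    toneAux X F G (uin k f) = tin k (f ⊵ₗ X) := rfl

variable (k C) in
/-- The unit morphism `C(-, -) ⟶ [X, X]`. -/
def tone (X : M) : unit k C ⟶ homTamb k C X X where
  app F G := toneAux X F G
  app_lmap f x := by induction x using unit_ind; simp
  app_rmap f x := by induction x using unit_ind; simp
  app_str K _ _ x := by
    induction x using unit_ind
    simp [whiskerLeft_actionHomLeft]

@[simp]
theorem tone_app_uin (X : M) {F G : C} (f : F ⟶ G) :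
    (tone k C X).app F G (uin k f) = tin k (f ⊵ₗ X) := rfl

theorem tmul_assoc (X Y Z T : M) :
    compMap (tmul k C X Y Z) (𝟙 (homTamb k C Z T)) ≫ tmul k C X Z T =
      (assoc _ _ _).hom ≫ compMap (𝟙 (homTamb k C X Y)) (tmul k C Y Z T) ≫ tmul k C X Y T :=
  comp_hom_ext₃ fun F G H L a b c => by
    induction a using t_ind
    induction b using t_ind
    induction c using t_ind
    simp

theorem tone_tmul (X Y : M) :
    compMap (tone k C X) (𝟙 (homTamb k C X Y)) ≫ tmul k C X X Y = (lUnitor _).hom :=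
  comp_hom_ext fun F G H a b => by
    induction a using unit_ind
    induction b using t_ind
    simp

theorem tmul_tone (X Y : M) :
    compMap (𝟙 (homTamb k C X Y)) (tone k C Y) ≫ tmul k C X Y Y = (rUnitor _).hom :=
  comp_hom_ext fun F G H a b => by
    induction a using t_ind
    induction b using unit_ind
    simp

/-! ### Composition of the Tambara modules `𝕎(Hom(- X, Y))` -/

variable (k C) in
/-- The morphism `𝕎(Hom(- X, Y)) ⋄ 𝕎(Hom(- Y, Z)) ⟶ 𝕎(Hom(- X, Z))` induced by the structure
morphism of `𝕎` and the composition of presheaves. -/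
def wmul (X Y Z : M) : comp (W (homPsh k C X Y)) (W (homPsh k C Y Z)) ⟶ W (homPsh k C X Z) :=
  wmu _ _ ≫ W.map (compPsh k C X Y Z)

@[simp]
theorem wmul_app_cpair {X Y Z : M} {F L G H K : C} (f : F ⟶ L ⊗ H) (b : H ⊙ₗ X ⟶ Y)
    (g : L ⟶ G ⊗ K) (c : K ⊙ₗ Y ⟶ Z) :
    (wmul k C X Y Z).app F G (cpair _ _ L (wmk (homPsh k C X Y) H f (hin k b))
      (wmk (homPsh k C Y Z) K g (hin k c))) =
    wmk (homPsh k C X Z) (K ⊗ H) (f ≫ g ▷ H ≫ (α_ G K H).hom)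
      (hin k ((αₗ K H X).hom ≫ K ⊴ₗ b ≫ c)) := by
  simp [wmul]

variable (k C) in
/-- The morphism `C(-, -) ⟶ 𝕎(Hom(- X, X))` induced by the unit morphism of `𝕎` and the unit
of `Hom(- X, X)`. -/
def wone (X : M) : unit k C ⟶ W (homPsh k C X X) :=
  weps k C ≫ W.map (onePsh k C X)

@[simp]
theorem wone_app_uin (X : M) {F G : C} (f : F ⟶ G) :
    (wone k C X).app F G (uin k f) =
      wmk (homPsh k C X X) (𝟙_ C) (f ≫ (ρ_ G).inv) (hin k (λₗ X).hom) := by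
  simp [wone]

theorem wh_ind {X Y : M} {F G : C} {p : (W (homPsh k C X Y)).obj F G → Prop}
    (x : (W (homPsh k C X Y)).obj F G) (h0 : p 0) (hadd : ∀ x y, p x → p y → p (x + y))
    (hmk : ∀ H f b, p (wmk (homPsh k C X Y) H f (hin k b))) : p x :=
  w_ind x h0 hadd fun H f b => hmk H f b

theorem wmul_assoc (X Y Z T : M) :
    compMap (wmul k C X Y Z) (𝟙 (W (homPsh k C Z T))) ≫ wmul k C X Z T =
      (assoc _ _ _).hom ≫ compMap (𝟙 (W (homPsh k C X Y))) (wmul k C Y Z T) ≫ wmul k C X Y T :=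
  comp_hom_ext₃ fun F G H L a b c => by
    induction a using wh_ind with
    | h0 => simp
    | hadd x y hx hy => simp only [map_add, LinearMap.add_apply, hx, hy]
    | hmk H₁ f a =>
    induction b using wh_ind with
    | h0 => simp
    | hadd x y hx hy => simp only [map_add, LinearMap.add_apply, hx, hy]
    | hmk H₂ g b =>
    induction c using wh_ind with
    | h0 => simp
    | hadd x y hx hy => simp only [map_add, hx, hy]
    | hmk H₃ h c =>
    have e := wmk_rel (P := homPsh k C X T) (α_ H₃ H₂ H₁).hom
      (f ≫ (g ≫ h ▷ H₂ ≫ (α_ G H₃ H₂).hom) ▷ H₁ ≫ (α_ G (H₃ ⊗ H₂) H₁).hom)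
      (hin k ((αₗ H₃ (H₂ ⊗ H₁) X).hom ≫ H₃ ⊴ₗ ((αₗ H₂ H₁ X).hom ≫ H₂ ⊴ₗ a ≫ b) ≫ c))
    rw [homPsh_map] at e
    simp only [comp_app, assoc_hom_app, compMap_app_cpair, id_app, wmul_app_cpair]
    convert e using 2
    · simp
    · simp

theorem wone_wmul (X Y : M) :
    compMap (wone k C X) (𝟙 (W (homPsh k C X Y))) ≫ wmul k C X X Y = (lUnitor _).hom :=
  comp_hom_ext fun F G H a b => by
    induction a using unit_ind
    rename_i f
    induction b using wh_ind with
    | h0 => simp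
    | hadd x y hx hy => simp only [map_add, hx, hy]
    | hmk K g b =>
    have e := wmk_rel (P := homPsh k C X Y) (ρ_ K).inv (f ≫ g)
      (hin k ((αₗ K (𝟙_ C) X).hom ≫ K ⊴ₗ (λₗ X).hom ≫ b))
    rw [homPsh_map] at e
    simp only [comp_app, compMap_app_cpair, id_app, wmul_app_cpair, wone_app_uin, lUnitor_hom_app,
      lact_uin, W_lmap_wmk]
    refine Eq.trans ?_ (e.trans ?_)
    · simp
    · rw [← rightUnitor_actionHom_assoc, inv_hom_actionHomLeft_assoc]

theorem wmul_wone (X Y : M) :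
    compMap (𝟙 (W (homPsh k C X Y))) (wone k C Y) ≫ wmul k C X Y Y = (rUnitor _).hom :=
  comp_hom_ext fun F G H a b => by
    induction b using unit_ind
    rename_i f
    induction a using wh_ind with
    | h0 => simp
    | hadd x y hx hy => simp only [map_add, LinearMap.add_apply, hx, hy]
    | hmk K g b =>
    have e := wmk_rel (P := homPsh k C X Y) (λ_ K).inv (g ≫ f ▷ K)
      (hin k ((αₗ (𝟙_ C) K X).hom ≫ 𝟙_ C ⊴ₗ b ≫ (λₗ Y).hom))
    rw [homPsh_map] at e
    simp only [comp_app, compMap_app_cpair, id_app, wmul_app_cpair, wone_app_uin, rUnitor_hom_app,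
      ract_uin, W_rmap_wmk]
    refine Eq.trans ?_ (e.trans ?_)
    · simp
    · rw [← actionUnitIso_hom_naturality, ← leftUnitor_actionHom_assoc,
        inv_hom_actionHomLeft_assoc]

/-! ### Monoids and bimodules -/

variable (k C)

/-- The monoid `[X, X]` of Tambara modules. -/
def homMon (X : M) : Mon (TambMod k C) where
  X := homTamb k C X X
  mon :=
    { one := tone k C X
      mul := tmul k C X X X
      one_mul := tone_tmul X X
      mul_one := tmul_tone X X
      mul_assoc := tmul_assoc X X X X }

/-- The monoid `𝕎(Hom(- X, X))` of Tambara modules. -/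
def WMon (X : M) : Mon (TambMod k C) where
  X := W (homPsh k C X X)
  mon :=
    { one := wone k C X
      mul := wmul k C X X X
      one_mul := wone_wmul X X
      mul_one := wmul_wone X X
      mul_assoc := wmul_assoc X X X X }

/-- The `[X, X]`-`[Y, Y]`-bimodule `[X, Y]`. -/
def homBimod (X Y : M) : Bimod (homMon k C X) (homMon k C Y) where
  X := homTamb k C X Y
  actLeft := tmul k C X X Y
  one_actLeft := tone_tmul X Y
  left_assoc := tmul_assoc X X X Y
  actRight := tmul k C X Y Y
  actRight_one := tmul_tone X Y
  right_assoc := ((Iso.eq_inv_comp _).2 (tmul_assoc X Y Y Y).symm)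
  middle_assoc := tmul_assoc X X Y Y

/-- The `𝕎(Hom(- X, X))`-`𝕎(Hom(- Y, Y))`-bimodule `𝕎(Hom(- X, Y))`. -/
def WBimod (X Y : M) : Bimod (WMon k C X) (WMon k C Y) where
  X := W (homPsh k C X Y)
  actLeft := wmul k C X X Y
  one_actLeft := wone_wmul X Y
  left_assoc := wmul_assoc X X X Y
  actRight := wmul k C X Y Y
  actRight_one := wmul_wone X Y
  right_assoc := ((Iso.eq_inv_comp _).2 (wmul_assoc X Y Y Y).symm)
  middle_assoc := wmul_assoc X X Y Y

end Monoids

end TambMod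

/-- Restriction of a bimodule along monoid morphisms. -/
def restrictBimod {V : Type*} [Category* V] [MonoidalCategory V] {A A' B B' : Mon V} (f : A ⟶ A')
    (g : B ⟶ B') (N : Bimod A' B') : Bimod A B where
  X := N.X
  actLeft := f.hom ▷ N.X ≫ N.actLeft
  one_actLeft := by
    rw [← comp_whiskerRight_assoc, IsMonHom.one_hom, N.one_actLeft]
  left_assoc := by
    rw [← comp_whiskerRight_assoc, IsMonHom.mul_hom, MonoidalCategory.tensorHom_def,
      whisker_exchange_assoc]
    simp
  actRight := N.X ◁ g.hom ≫ N.actRight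
  actRight_one := by
    rw [← whiskerLeft_comp_assoc, IsMonHom.one_hom, N.actRight_one]
  right_assoc := by
    rw [← whiskerLeft_comp_assoc, IsMonHom.mul_hom, MonoidalCategory.tensorHom_def',
      ← whisker_exchange_assoc]
    simp
  middle_assoc := by
    have e := (whisker_exchange N.actLeft g.hom).symm
    rw [whisker_exchange_assoc, comp_whiskerRight_assoc, reassoc_of% e]
    simp

end Tambara

end

/-! The morphism ω reads a class f ⊗ b, with f : F ⟶ G ⊗ H and b : H X ⟶ Y, as the composite F X ⟶
(G ⊗ H) X ≅ G (H X) ⟶ G Y. Naturality of the action associator makes this independent of the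
representative in the coend (`omegaAux_rel`). Compatibility with the profunctor and Tambara
structures comes from functoriality, the interchange law and the pentagon of the action.

The algebraic claims all reduce to two identities. `wone_omega` says that ω preserves units.
`wmul_omega` says that ω preserves composition for an arbitrary triple X, Y, Z. The triple (X, X, X)
gives multiplicativity of the monoid morphism, and the triples (X, X, Y) and (X, Y, Y) give the left
and right bimodule laws.

Invertibility is the co-Yoneda lemma combined with duality. For an exact pairing of G with G', both
G' ⊗ - ⊣ G ⊗ - on C and the induced adjunction between the actions of G' and G on M are available,
so ∫^H C(F, G ⊗ H) ⊗ M(H X, Y) ≅ ∫^H C(G' ⊗ F, H) ⊗ M(H X, Y) ≅ M((G' ⊗ F) X, Y) ≅ M(F X, G Y).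
Concretely, the inverse sends t : F X ⟶ G Y to the class of the adjunction unit F ⟶ G ⊗ (G' ⊗ F)
paired with the transpose of t. Applying ω to this class returns t by a triangle identity
(`coevaluation_actTranspose`). In the other direction, the transpose of ω(f ⊗ b) factors as the
transpose of f acting on X, followed by b (`actTranspose_comp`). The coend relation moves the
transpose of f back to the left factor, where it recombines with the unit to give f. -/

noncomputable section

namespace Tambara

/-! ### Transposition along the action of a dual object. -/

section Duality

variable {C : Type u} [SmallCategory C] [MonoidalCategory C]
  {M : Type v} [Category.{u} M] [MonoidalLeftAction C M]

/-- Transposing along G' ⊗ - ⊣ G ⊗ - amounts to composing with the unit. This puts the chosen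
representative of the inverse of ω in terms of the hom equivalence, so that transposing back and
forth cancels. -/
theorem tensorLeftHomEquiv_apply_eq {F G G' H : C} [ExactPairing G G'] (h : G' ⊗ F ⟶ H) :
    ((λ_ F).inv ≫ η_ G G' ▷ F ≫ (α_ G G' F).hom) ≫ G ◁ h = tensorLeftHomEquiv F G G' H h := by
  simp [tensorLeftHomEquiv]

/-- The transpose of a morphism `Z ⟶ G Y` along the adjunction between the actions of `G` and of
its right dual. -/
def actTranspose {G : C} (G' : C) [ExactPairing G G'] {Y Z : M} (t : Z ⟶ G ⊙ₗ Y) : G' ⊙ₗ Z ⟶ Y :=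
  G' ⊴ₗ t ≫ (αₗ G' G Y).inv ≫ ε_ G G' ⊵ₗ Y ≫ (λₗ Y).hom

/-- This is half of the adjunction between the actions of G' and G: transposing and then composing
with the unit at Z recovers the morphism. The unit is natural in Z, so t can be moved to the front;
what remains is a triangle identity evaluated at Y. -/
theorem coevaluation_actTranspose {G : C} (G' : C) [ExactPairing G G'] {Y Z : M}
    (t : Z ⟶ G ⊙ₗ Y) :
    (λₗ[C] Z).inv ≫ η_ G G' ⊵ₗ Z ≫ (αₗ G G' Z).hom ≫ G ⊴ₗ actTranspose G' t = t := by
  -- Naturality of the adjunction unit with respect to t, obtained from the unitor, the interchange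
  -- law with η, and the associator in turn.
  have nat : (λₗ[C] Z).inv ≫ η_ G G' ⊵ₗ Z ≫ (αₗ G G' Z).hom ≫ G ⊴ₗ G' ⊴ₗ t =
      t ≫ (λₗ[C] (G ⊙ₗ Y)).inv ≫ η_ G G' ⊵ₗ (G ⊙ₗ Y) ≫ (αₗ G G' (G ⊙ₗ Y)).hom := by
    have e := tensor_actionHomRight G G' t
    have e' := action_exchange (η_ G G') t
    have e'' : (αₗ G G' Z).hom ≫ G ⊴ₗ G' ⊴ₗ t = (G ⊗ G') ⊴ₗ t ≫ (αₗ G G' (G ⊙ₗ Y)).hom := by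
      rw [e]; simp
    rw [e'', ← reassoc_of% e', actionUnitIso_inv_naturality_assoc]
  -- The triangle identity for G in C, transported by acting on Y. The associators and unitors of
  -- the action are traded for those of C by the pentagon and the unit triangle.
  have tri : (λₗ[C] (G ⊙ₗ Y)).inv ≫ η_ G G' ⊵ₗ (G ⊙ₗ Y) ≫ (αₗ G G' (G ⊙ₗ Y)).hom ≫
      G ⊴ₗ (αₗ G' G Y).inv ≫ G ⊴ₗ ε_ G G' ⊵ₗ Y ≫ G ⊴ₗ (λₗ Y).hom = 𝟙 _ := by
    have e := congrArg (fun f => f ⊵ₗ Y) (ExactPairing.evaluation_coevaluation G G')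
    simp only [comp_actionHomLeft] at e
    have e₁ : (αₗ G (G' ⊗ G) Y).hom ≫ G ⊴ₗ ε_ G G' ⊵ₗ Y ≫ G ⊴ₗ (λₗ Y).hom =
        (G ◁ ε_ G G') ⊵ₗ Y ≫ (ρ_ G).hom ⊵ₗ Y := by
      simp
    rw [actionHomLeft_action, Category.assoc, Category.assoc, ← associator_actionHom_assoc,
      actionHomRight_hom_inv_assoc, e₁, reassoc_of% e, inv_hom_actionHomLeft, Category.comp_id,
      leftUnitor_actionHom]
    simp
  simp only [actTranspose, actionHomRight_comp]
  rw [reassoc_of% nat, tri, Category.comp_id]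

/-- The transpose of `F X ⟶ G Y` factoring through `f : F ⟶ G ⊗ H` and `b : H X ⟶ Y`. -/
theorem actTranspose_comp {F G H : C} (G' : C) [ExactPairing G G'] {X Y : M} (f : F ⟶ G ⊗ H)
    (b : H ⊙ₗ X ⟶ Y) :
    (αₗ G' F X).hom ≫ actTranspose G' (f ⊵ₗ X ≫ (αₗ G H X).hom ≫ G ⊴ₗ b) =
      ((tensorLeftHomEquiv F G G' H).symm f) ⊵ₗ X ≫ b := by
  -- Naturality of the adjunction counit with respect to b.
  have e₁ : G' ⊴ₗ G ⊴ₗ b ≫ (αₗ G' G Y).inv ≫ ε_ G G' ⊵ₗ Y ≫ (λₗ Y).hom =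
      (αₗ G' G (H ⊙ₗ X)).inv ≫ ε_ G G' ⊵ₗ (H ⊙ₗ X) ≫ (λₗ (H ⊙ₗ X)).hom ≫ b := by
    have e := action_exchange (ε_ G G') b
    rw [tensor_actionHomRight, Category.assoc, Category.assoc, Iso.eq_inv_comp] at *
    rw [reassoc_of% e, actionUnitIso_hom_naturality]
  -- The pentagon in inverse form: it lets the counit at H X be replaced by ε ▷ H acting on X, which
  -- is the counit occurring in the transpose of f.
  have e₂ : (αₗ G' (G ⊗ H) X).inv ≫ (α_ G' G H).inv ⊵ₗ X =
      G' ⊴ₗ (αₗ G H X).hom ≫ (αₗ G' G (H ⊙ₗ X)).inv ≫ (αₗ (G' ⊗ G) H X).inv := by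
    rw [Iso.inv_comp_eq, ← cancel_epi ((α_ G' G H).hom ⊵ₗ X), associator_actionHom_assoc]
    simp
  simp only [actTranspose, actionHomRight_comp, Category.assoc]
  rw [e₁]
  simp [tensorLeftHomEquiv, reassoc_of% e₂]

end Duality

/-! ### The comparison morphism ω. -/

namespace TambMod

variable {k : Type w} [Field k] {C : Type u} [SmallCategory C] [Preadditive C] [Linear k C]
  [MonoidalCategory C] [MonoidalPreadditive C] [MonoidalLinear k C]
  {M : Type v} [Category.{u} M] [Preadditive M] [Linear k M] [MonoidalLeftAction C M]
  [IsLinearAction k C M]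

/-- The bilinear map `f ⊗ b ↦ G b ∘ α ∘ f X`. -/
def omegaAux (X Y : M) (F G H : C) :
    (F ⟶ G ⊗ H) →ₗ[k] (homPsh k C X Y).obj H →ₗ[k] (homTamb k C X Y).obj F G :=
  LinearMap.mk₂ k
    (fun f b => tin k (actL k X f ≫ (αₗ G H X).hom ≫ actR k G (hout b)))
    (by simp) (by simp) (by simp) (by simp)

@[simp]
theorem omegaAux_apply {X Y : M} {F G H : C} (f : F ⟶ G ⊗ H) (b : H ⊙ₗ X ⟶ Y) :
    omegaAux X Y F G H f (hin k b) = tin k (f ⊵ₗ X ≫ (αₗ G H X).hom ≫ G ⊴ₗ b) := rfl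

/-- Up to associators, G ◁ h acts on X as G applied to the action of h on X, so it can be absorbed
into b. This is the extranaturality that lets the bilinear maps descend to the coend. -/
theorem omegaAux_rel {X Y : M} {F G H H' : C} (h : H ⟶ H') (f : F ⟶ G ⊗ H)
    (b : (homPsh k C X Y).obj H') :
    omegaAux X Y F G H' (f ≫ G ◁ h) b = omegaAux X Y F G H f ((homPsh k C X Y).map h b) := by
  induction b using h_ind
  simp [whiskerLeft_actionHomLeft]

/-- The linear map underlying the comparison morphism. -/
def omegaApp (X Y : M) (F G : C) :
    (W (homPsh k C X Y)).obj F G →ₗ[k] (homTamb k C X Y).obj F G :=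
  wLift (omegaAux X Y F G) fun _ _ h f b => omegaAux_rel h f b

@[simp]
theorem omegaApp_wmk {X Y : M} {F G H : C} (f : F ⟶ G ⊗ H) (b : H ⊙ₗ X ⟶ Y) :
    omegaApp X Y F G (wmk (homPsh k C X Y) H f (hin k b)) =
      tin k (f ⊵ₗ X ≫ (αₗ G H X).hom ≫ G ⊴ₗ b) := by
  rw [omegaApp, wLift_wmk, omegaAux_apply]

variable (k C) in
/-- The comparison morphism `𝕎(Hom(- X, Y)) ⟶ [X, Y]`. -/
def omega (X Y : M) : W (homPsh k C X Y) ⟶ homTamb k C X Y where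
  app := omegaApp X Y
  app_lmap f x := by
    induction x using wh_ind with
    | h0 => simp
    | hadd x y hx hy => simp only [map_add, hx, hy]
    | hmk H g b => simp
  app_rmap g x := by
    induction x using wh_ind with
    | h0 => simp
    | hadd x y hx hy => simp only [map_add, hx, hy]
    | hmk H f b =>
      rw [W_rmap_wmk, omegaApp_wmk, omegaApp_wmk, homTamb_rmap]
      -- Interchange: g acts before or after b with the same result.
      simp only [comp_actionHomLeft, Category.assoc, action_exchange, actionHomLeft_action,
        Iso.hom_inv_id_assoc]
  app_str K F G x := by
    induction x using wh_ind with
    | h0 => simp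
    | hadd x y hx hy => simp only [map_add, hx, hy]
    | hmk H f b =>
      rw [W_str_wmk, omegaApp_wmk, omegaApp_wmk, homTamb_str]
      -- The pentagon of the action compares the two ways of rebracketing K, G and H acting on X.
      simp [associator_act_inv]

@[simp]
theorem omega_app_wmk {X Y : M} {F G H : C} (f : F ⟶ G ⊗ H) (b : H ⊙ₗ X ⟶ Y) :
    (omega k C X Y).app F G (wmk (homPsh k C X Y) H f (hin k b)) =
      tin k (f ⊵ₗ X ≫ (αₗ G H X).hom ≫ G ⊴ₗ b) :=
  omegaApp_wmk f b

/-! ### Compatibility of ω with units and composition. -/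

/-- The right unitor inserted by the unit of 𝕎 cancels against the left unitor of the action on X,
by the unit triangle. -/
theorem wone_omega (X : M) : wone k C X ≫ omega k C X X = tone k C X :=
  hom_ext fun F G x => by
    induction x using unit_ind
    rw [comp_app, wone_app_uin, omega_app_wmk, tone_app_uin]
    simp [← rightUnitor_actionHom]

/-- Three independent objects are kept so that one identity serves both the monoid law and the two
bimodule laws. It rests on interchanging g with a, followed by the pentagon for G, K and H. -/
theorem wmul_omega (X Y Z : M) :
    wmul k C X Y Z ≫ omega k C X Z =
      compMap (omega k C X Y) (omega k C Y Z) ≫ tmul k C X Y Z :=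
  comp_hom_ext fun F G L a b => by
    induction a using wh_ind with
    | h0 => simp
    | hadd x y hx hy => simp only [map_add, LinearMap.add_apply, hx, hy]
    | hmk H f a =>
    induction b using wh_ind with
    | h0 => simp
    | hadd x y hx hy => simp only [map_add, hx, hy]
    | hmk K g b =>
    rw [comp_app, comp_app, wmul_app_cpair, compMap_app_cpair, omega_app_wmk, omega_app_wmk,
      omega_app_wmk, tmul_app_cpair]
    congr 1
    -- On the 𝕎 side g acts before a is applied; in the composite of the two images it acts after a.
    have e := action_exchange g a
    simp only [comp_actionHomLeft, Category.assoc, actionHomRight_comp]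
    rw [reassoc_of% e]
    simp

/-! ### The inverse of ω in the presence of duals. -/

/-- The inverse of the comparison morphism at an object `G` with a dual `G'`. -/
def omegaInv (X Y : M) (F G G' : C) [ExactPairing G G'] :
    (homTamb k C X Y).obj F G →ₗ[k] (W (homPsh k C X Y)).obj F G :=
  wmk (homPsh k C X Y) (G' ⊗ F) ((λ_ F).inv ≫ η_ G G' ▷ F ≫ (α_ G G' F).hom) ∘ₗ hin k ∘ₗ
    Linear.leftComp k Y (αₗ G' F X).hom ∘ₗ
    Linear.rightComp k _ ((αₗ G' G Y).inv ≫ ε_ G G' ⊵ₗ Y ≫ (λₗ Y).hom) ∘ₗ actR k G' ∘ₗ tout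

/-- The inverse is defined as a chain of linear maps so that its linearity is automatic; this form
exposes the transpose. The summand G' ⊗ F is the object representing C(F, G ⊗ -), as co-Yoneda
dictates. -/
theorem omegaInv_tin {X Y : M} {F G : C} (G' : C) [ExactPairing G G'] (t : F ⊙ₗ X ⟶ G ⊙ₗ Y) :
    omegaInv X Y F G G' (tin k t) =
      wmk (homPsh k C X Y) (G' ⊗ F) ((λ_ F).inv ≫ η_ G G' ▷ F ≫ (α_ G G' F).hom)
        (hin k ((αₗ G' F X).hom ≫ actTranspose G' t)) := rfl

/-- The co-Yoneda argument: by `actTranspose_comp` the second factor is b restricted along the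
transpose of f. The coend relation `wmk_rel` slides that transpose onto the unit, and the two
compose to f. -/
theorem omegaInv_omega {X Y : M} (F G G' : C) [ExactPairing G G']
    (x : (W (homPsh k C X Y)).obj F G) :
    omegaInv X Y F G G' ((omega k C X Y).app F G x) = x := by
  induction x using wh_ind with
  | h0 => simp
  | hadd x y hx hy => simp only [map_add, hx, hy]
  | hmk H f b =>
    rw [omega_app_wmk, omegaInv_tin, actTranspose_comp, ← homPsh_map, ← wmk_rel,
      tensorLeftHomEquiv_apply_eq, Equiv.apply_symm_apply]

/-- The unit F ⟶ G ⊗ (G' ⊗ F) of the adjunction on C, acting on X, is up to associators the unit of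
the adjunction on M at F X. The claim then is `coevaluation_actTranspose` with Z = F X. -/
theorem omega_omegaInv {X Y : M} (F G G' : C) [ExactPairing G G']
    (x : (homTamb k C X Y).obj F G) :
    (omega k C X Y).app F G (omegaInv X Y F G G' x) = x := by
  induction x using t_ind with
  | h t =>
    rw [omegaInv_tin, omega_app_wmk]
    congr 1
    refine Eq.trans ?_ (coevaluation_actTranspose G' t)
    simp only [comp_actionHomLeft, actionHomRight_comp, Category.assoc]
    -- Left unit coherence: the inverse unitor of F, acting on X, expressed by that of the object F
    -- X.
    have e : (λ_ F).inv ⊵ₗ X = (λₗ[C] (F ⊙ₗ X)).inv ≫ (αₗ (𝟙_ C) F X).inv := by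
      rw [← cancel_mono ((λ_ F).hom ⊵ₗ X), inv_hom_actionHomLeft, leftUnitor_actionHom]
      simp
    rw [associator_actionHom_assoc, e]
    simp

/-- Pointwise inverses suffice: naturality and Tambara compatibility of the inverse follow from
those of ω through `isoMk`, so no coherence between the chosen duals of different objects is needed.
-/
instance isIso_omega [RightRigidCategory C] (X Y : M) : IsIso (omega k C X Y) :=
  (isoMk (omega k C X Y) (fun F G => omegaInv X Y F G Gᘁ) (fun F G => omegaInv_omega F G Gᘁ)
    (fun F G => omega_omegaInv F G Gᘁ)).isIso_hom

/-! ### ω as a morphism of monoids and of bimodules. -/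

variable (k C)

/-- The comparison morphism as a morphism of monoids `𝕎(Hom(- X, X)) ⟶ [X, X]`. -/
def omegaMon (X : M) : WMon k C X ⟶ homMon k C X where
  hom := omega k C X X
  isMonHom_hom :=
    { one_hom := wone_omega X
      mul_hom := wmul_omega X X X }

/-- The comparison morphism as a morphism of bimodules. -/
def omegaBimod (X Y : M) :
    WBimod k C X Y ⟶ restrictBimod (omegaMon k C X) (omegaMon k C Y) (homBimod k C X Y) where
  hom := omega k C X Y
  left_act_hom := by
    -- `wmul_omega` applies ω to both factors at once. The bimodule law applies it to the bimodule
    -- factor and then, through the restricted action, to the monoid factor; functoriality of ⋄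
    -- identifies the two. The right action is symmetric.
    refine (wmul_omega X X Y).trans ?_
    change _ = compMap (𝟙 _) (omega k C X Y) ≫ compMap (omega k C X X) (𝟙 _) ≫ tmul k C X X Y
    rw [← Category.assoc, ← compMap_comp, Category.id_comp, Category.comp_id]
  right_act_hom := by
    refine (wmul_omega X Y Y).trans ?_
    change _ = compMap (omega k C X Y) (𝟙 _) ≫ compMap (𝟙 _) (omega k C Y Y) ≫ tmul k C X Y Y
    rw [← Category.assoc, ← compMap_comp, Category.id_comp, Category.comp_id]

end TambMod

/-! ### Invertibility of the structured morphisms and assembly. -/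

/-- A bimodule morphism is invertible if its underlying morphism is. -/
theorem isIso_bimod_of_isIso_hom {V : Type*} [Category* V] [MonoidalCategory V] {A B : Mon V}
    {N N' : Bimod A B} (f : N ⟶ N') [IsIso f.hom] : IsIso f :=
  (Bimod.isoOfIso (asIso f.hom) f.left_act_hom f.right_act_hom).isIso_hom

end Tambara

end

theorem mainTheorem8 {k : Type w} [Field k]
    {C : Type u} [SmallCategory C] [Preadditive C] [Linear k C]
    [MonoidalCategory C] [MonoidalPreadditive C] [MonoidalLinear k C]
    {M : Type v} [Category.{u} M] [Preadditive M] [Linear k M]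
    [MonoidalLeftAction C M] [IsLinearAction k C M] :
    ∃ ω : ∀ X Y : M, Tambara.TambMod.W (Tambara.homPsh k C X Y) ⟶ Tambara.homTamb k C X Y,
      (∀ (X Y : M) (F G H : C) (f : F ⟶ G ⊗ H) (b : H ⊙ₗ X ⟶ Y),
        (ω X Y).app F G
            (Tambara.TambMod.wmk (Tambara.homPsh k C X Y) H f (Tambara.hin k b)) =
          Tambara.tin k (f ⊵ₗ X ≫ (αₗ G H X).hom ≫ G ⊴ₗ b)) ∧
      ∃ ωm : ∀ X : M, Tambara.TambMod.WMon k C X ⟶ Tambara.TambMod.homMon k C X,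
        (∀ X : M, (ωm X).hom = ω X X) ∧
        ∃ ωb : ∀ X Y : M, Tambara.TambMod.WBimod k C X Y ⟶
            Tambara.restrictBimod (ωm X) (ωm Y) (Tambara.TambMod.homBimod k C X Y),
          (∀ X Y : M, (ωb X Y).hom = ω X Y) ∧
          (Nonempty (RigidCategory C) →
            (∀ X Y : M, IsIso (ω X Y)) ∧ (∀ X : M, IsIso (ωm X)) ∧
              ∀ X Y : M, IsIso (ωb X Y)) :=
  ⟨fun X Y => Tambara.TambMod.omega k C X Y, fun _ _ _ _ _ f b => Tambara.TambMod.omega_app_wmk f b,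
    fun X => Tambara.TambMod.omegaMon k C X, fun _ => rfl,
    fun X Y => Tambara.TambMod.omegaBimod k C X Y, fun _ _ => rfl, by
      rintro ⟨_⟩
      refine ⟨fun X Y => inferInstance, fun X => ?_, fun X Y => ?_⟩
      · have : IsIso (Tambara.TambMod.omegaMon k C X).hom := Tambara.TambMod.isIso_omega X X
        -- The forgetful functor from monoids reflects isomorphisms, so invertibility of the
        -- underlying Tambara morphism is restated through that functor.
        have : IsIso ((Mon.forget (Tambara.TambMod k C)).map (Tambara.TambMod.omegaMon k C X)) := this
        exact isIso_of_reflects_iso _ (Mon.forget _)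
      · have : IsIso (Tambara.TambMod.omegaBimod k C X Y).hom := Tambara.TambMod.isIso_omega X Y
        exact Tambara.isIso_bimod_of_isIso_hom _⟩
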